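/- **Theorem (reverse cascade implies energy equality).** Let $\nu>0$ and let $u$ be a Leray solution on $\mathbb{R}_+\times\mathbb{R}^3$ of the incompressible Navier–Stokes equations $\partial_t u-\nu\Delta u+(u\cdot\nabla)u=-\nabla\Pi$, $\operatorname{div}u=0$. This means: $u:[0,\infty)\to L^2(\mathbb{R}^3)^3$ is weakly continuous, $u\in L^\infty(\mathbb{R}_+;L^2)\cap L^2(\mathbb{R}_+;\dot H^1)$, $\operatorname{div}u=0$, the equation holds weakly against divergence-free test fields, and the energy inequality $$\|u(t)\|_{L^2}^2+2\nu\int_s^t\|\nabla u(\tau)\|_{L^2}^2\,d\tau\le\|u(s)\|_{L^2}^2\qquad\text{for all }t\ge s \tag{1}$$ holds for $s=0$ and for almost every $s\ge 0$. Let $\chi\in C^\infty(\mathbb{R}_+;\mathbb{R}_+)$ with $\chi(r)=1$ for $r<1/2$ and $\chi(r)=0$ for $r>2$, and for $K>0$ let $S_K=\chi(\sqrt{-\Delta}/K)$ be the low-pass filter, i.e. the Fourier multiplier with symbol $\chi(|\xi|/K)$. Let $0\le T_0\le T_1$ and suppose that $u$ has a "reverse cascade" on $[T_0,T_1]$, i.e.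 the nonlinear term transfers energy towards low frequencies: for every $K>0$ and almost every $t\in[T_0,T_1]$, $$\sum_{i,j}\int_{\mathbb{R}^3}S_K^*S_K(u_iu_j)\,\partial_iu_j(t,x)\,dx\;\ge\;0 .$$ Then the energy equality $$\|u(s)\|_{L^2}^2=\|u(t)\|_{L^2}^2+2\nu\int_s^t\|\nabla u(\tau)\|_{L^2}^2\,d\tau$$ holds for all $s\le t$ in $(T_0,T_1]$, and it holds also for $s=T_0$ and all $t\in[T_0,T_1]$ (in particular for $s=T_0$, $t=T_1$) provided that $T_0$ is one of the times $s$ for which (1) holds, which is the case if $T_0=0$ and for almost every $T_0$. -/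

import Mathlib

open MeasureTheory Set
open scoped ContDiff FourierTransform Laplacian Gradient

noncomputable section

namespace NavierStokes

/-- Euclidean three-space. -/
abbrev R3 := EuclideanSpace ℝ (Fin 3)

/-- Square-integrable vector fields on `ℝ³`; the norm is `‖f‖ = (∫ |f(x)|² dx)^(1/2)`. -/
abbrev L2 := Lp R3 2 (volume : Measure R3)

/-- The `i`-th vector of the canonical basis of `ℝ³`. -/
def e (i : Fin 3) : R3 := EuclideanSpace.single i 1

/-- Smooth compactly supported functions on `ℝ³`. -/
def IsTest {F : Type*} [NormedAddCommGroup F] [NormedSpace ℝ F] (φ : R3 → F) : Prop :=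
  ContDiff ℝ ∞ φ ∧ HasCompactSupport φ

/-- `g = ∂ᵢ f` in the weak sense, componentwise. -/
def IsWeakPartial (i : Fin 3) (f g : L2) : Prop :=
  ∀ φ : R3 → ℝ, IsTest φ → ∫ x, (fderiv ℝ φ x (e i)) • f x = -∫ x, φ x • g x

/-- `f ∈ H¹(ℝ³)`: all the weak first-order partial derivatives of `f` are in `L²`. -/
def MemH1 (f : L2) : Prop := ∀ i, ∃ g : L2, IsWeakPartial i f g

open Classical in
/-- The weak partial derivative `∂ᵢ f ∈ L²` (set to `0` if there is none in `L²`). -/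
def weakPartial (i : Fin 3) (f : L2) : L2 :=
  if h : ∃ g : L2, IsWeakPartial i f g then h.choose else 0

/-- `‖∇f‖²`, the square of the `L²` norm of the gradient, i.e. `∑ᵢⱼ ∫ |∂ᵢ fⱼ|²`. -/
def gradNormSq (f : L2) : ℝ := ∑ i, ‖weakPartial i f‖ ^ 2

/-- `div f = 0` in the sense of distributions. -/
def DivFree (f : L2) : Prop :=
  ∀ ψ : R3 → ℝ, IsTest ψ → ∫ x, inner ℝ (f x) (∇ ψ x) = 0

/-- The energy inequality with initial time `s`. -/
def EnergyInequalityFrom (ν : ℝ) (u : ℝ → L2) (s : ℝ) : Prop :=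
  ∀ t, s ≤ t → ‖u t‖ ^ 2 + 2 * ν * ∫ τ in s..t, gradNormSq (u τ) ≤ ‖u s‖ ^ 2

/-- The energy equality between the times `s` and `t`. -/
def EnergyEquality (ν : ℝ) (u : ℝ → L2) (s t : ℝ) : Prop :=
  ‖u s‖ ^ 2 = ‖u t‖ ^ 2 + 2 * ν * ∫ τ in s..t, gradNormSq (u τ)

/-- `u` is a Leray solution on `[0, ∞) × ℝ³` of the incompressible Navier-Stokes equations
`∂ₜu - νΔu + (u·∇)u = -∇Π`, `div u = 0`, with initial datum `u 0`.
The values of `u t` for `t < 0` play no role. -/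
structure IsLeraySolution (ν : ℝ) (u : ℝ → L2) : Prop where
  /-- `u` is weakly continuous in time with values in `L²`. -/
  weak_continuous : ∀ w : L2, ContinuousOn (fun t => inner ℝ (u t) w) (Ici 0)
  /-- `u` belongs to `L^∞(ℝ₊; L²)`. -/
  bounded : ∃ C : ℝ, ∀ t, 0 ≤ t → ‖u t‖ ≤ C
  /-- `u` belongs to `L²(ℝ₊; Ḣ¹)`. -/
  memH1 : ∀ᵐ t ∂(volume.restrict (Ici (0 : ℝ))), MemH1 (u t)
  integrable_gradNormSq : IntegrableOn (fun t => gradNormSq (u t)) (Ici 0)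
  divFree : ∀ t, 0 ≤ t → DivFree (u t)
  /-- The momentum equation, tested against divergence-free fields `φ` and integrated in time;
  `u · (Dφ u)` is `∑ᵢⱼ uᵢ uⱼ ∂ᵢφⱼ`. -/
  momentum : ∀ φ : R3 → R3, IsTest φ → (∀ x, ∑ i, fderiv ℝ φ x (e i) i = 0) →
    ∀ t, 0 ≤ t →
      (∫ x, inner ℝ (u t x) (φ x)) - ∫ x, inner ℝ (u 0 x) (φ x) =
        ∫ τ in (0 : ℝ)..t,
          (ν * (∫ x, inner ℝ (u τ x) (Δ φ x)) +
            ∫ x, inner ℝ (u τ x) (fderiv ℝ φ x (u τ x)))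
  /-- The energy inequality holds from the initial time and from almost every later time. -/
  energy_zero : EnergyInequalityFrom ν u 0
  energy_ae : ∀ᵐ s ∂(volume.restrict (Ici (0 : ℝ))), EnergyInequalityFrom ν u s

/-- A smooth profile `χ : [0, ∞) → [0, ∞)` of a low-pass filter. -/
structure IsCutoff (χ : ℝ → ℝ) : Prop where
  smooth : ContDiffOn ℝ ∞ χ (Ici 0)
  nonneg : ∀ r, 0 ≤ r → 0 ≤ χ r
  eq_one : ∀ r, 0 ≤ r → r < 1 / 2 → χ r = 1
  eq_zero : ∀ r, 2 < r → χ r = 0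

/-- `S_K* S_K f` for `f ∈ L¹(ℝ³)`, where `S_K = χ(√(-Δ) / K)`: the Fourier multiplier with the
real symbol `χ(|ξ| / K)²`. With Mathlib's normalisation `e^(-2πi x·ξ)` of the Fourier transform,
the frequency variable is `2πξ`. -/
def lowPassSq (χ : ℝ → ℝ) (K : ℝ) (f : R3 → ℝ) : R3 → ℂ :=
  𝓕⁻ (fun ξ : R3 =>
    ((χ (2 * Real.pi * ‖ξ‖ / K) ^ 2 : ℝ) : ℂ) * 𝓕 (fun x : R3 => (f x : ℂ)) ξ)

/-- `∑ᵢⱼ ∫ S_K* S_K (fᵢ fⱼ) ∂ᵢfⱼ dx` for `f ∈ H¹(ℝ³)` (the filtered function is real-valued). For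
a solution `u` of the Navier-Stokes equations, this is the rate at which the nonlinear term feeds
the energy `‖S_K u‖² / 2` of the frequencies below `K`. -/
def energyTransfer (χ : ℝ → ℝ) (K : ℝ) (f : L2) : ℝ :=
  ∑ i, ∑ j, ∫ x, (lowPassSq χ K (fun y => f y i * f y j) x).re * weakPartial i f x j

end NavierStokes

end

/-! Formally, pairing the equation with `S_K* S_K u` shows that half the derivative of `‖S_K u‖²` is
`-ν‖∇S_K u‖²` plus the energy transfer, which a reverse cascade makes nonnegative. So `‖S_K u(t)‖² +
2ν∫‖∇S_K u‖²` is nondecreasing in `t` for every `K`, and `K → ∞` gives the inequality opposite to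
Leray's (`IsLeraySolution.energy_ge`). The sign is used at each fixed `K`, so the cubic term never
has to converge.

Two points need care; both are settled on the Fourier side. The pressure: the residual of the
momentum equation annihilates solenoidal test fields, so its symbol is parallel to `ξ`
(`momentumSymbol_curl_free`), hence pointwise orthogonal to the transform of any solenoidal field
(`inner_hat_momentumSymbol`). The multiplier preserves this orthogonality, so no Leray projection is
needed.

Time regularity: `u` is only weakly continuous, and the filtered equation `X' = N` is known only in
integrated form, tested against the values of `X` itself. Since `N` is bounded at fixed `K`, this
suffices (`energy_growth`): `X` is Lipschitz, and the increments of `‖X‖²` are controlled up to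
errors quadratic in the time step, which vanish on refining a partition.

Plancherel turns the physical transfer integral into its Fourier counterpart (`integral_lowPassSq`).
Finally, if Leray's inequality holds from a time `r`, the two inequalities give equality from `r`.
Such times are dense, and subtracting two equalities with the same `r` reaches every pair of times
after `T₀`. -/

namespace NavierStokes

open Filter Topology
open scoped SchwartzMap LineDeriv

/-! ### Compactly supported functions in the Schwartz space -/

section Density

variable {E F : Type*} [NormedAddCommGroup E] [NormedSpace ℝ E]
  [NormedAddCommGroup F] [NormedSpace ℝ F]

/-- Truncation `x ↦ η(a x) f(x)` of a Schwartz function. -/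
noncomputable def truncate (η : 𝓢(E, ℝ)) (a : ℝ) (f : 𝓢(E, F)) : 𝓢(E, F) :=
  SchwartzMap.smulLeftCLM F (fun x => η (a • x)) f

lemma hasTemperateGrowth_comp_smul (η : 𝓢(E, ℝ)) (a : ℝ) :
    (fun x => η (a • x)).HasTemperateGrowth :=
  η.hasTemperateGrowth.comp (g := η) (f := fun x : E => a • x)
    (a • ContinuousLinearMap.id ℝ E).hasTemperateGrowth

lemma truncate_apply (η : 𝓢(E, ℝ)) (a : ℝ) (f : 𝓢(E, F)) (x : E) :
    truncate η a f x = η (a • x) • f x :=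
  SchwartzMap.smulLeftCLM_apply_apply (hasTemperateGrowth_comp_smul η a) f x

/-- The difference vanishes near any point with `a‖x‖ < 1`. Elsewhere `1 ≤ a‖x‖`, so one extra power
of `‖x‖` in the seminorm buys the factor `a`. -/
lemma seminorm_truncate_sub_le (η : 𝓢(E, ℝ)) (hη : ∀ x, ‖x‖ < 1 → η x = 1) (f : 𝓢(E, F))
    (k n : ℕ) : ∃ C : ℝ, ∀ a : ℝ, 0 < a → a ≤ 1 →
      SchwartzMap.seminorm ℝ k n (truncate η a f - f) ≤ a * C := by
  set p := fun k n => SchwartzMap.seminorm ℝ k n f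
  refine ⟨∑ i ∈ Finset.range (n + 1), (n.choose i : ℝ) * SchwartzMap.seminorm ℝ 0 i η *
    p (k + 1) (n - i) + p (k + 1) n, fun a ha ha1 => ?_⟩
  have hp : ∀ k n, 0 ≤ p k n := fun k n => apply_nonneg _ _
  have hC : 0 ≤ ∑ i ∈ Finset.range (n + 1), (n.choose i : ℝ) * SchwartzMap.seminorm ℝ 0 i η *
      p (k + 1) (n - i) + p (k + 1) n := by
    refine add_nonneg (Finset.sum_nonneg fun i _ => ?_) (hp _ _)
    exact mul_nonneg (mul_nonneg (by positivity) (apply_nonneg _ _)) (hp _ _)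
  refine SchwartzMap.seminorm_le_bound ℝ k n _ (mul_nonneg ha.le hC) fun x => ?_
  rcases lt_or_ge (a * ‖x‖) 1 with hx | hx
  · have : (truncate η a f - f : 𝓢(E, F)) =ᶠ[𝓝 x] (0 : E → F) := by
      have : ∀ᶠ y in 𝓝 x, a * ‖y‖ < 1 :=
        (Continuous.tendsto (by fun_prop) x).eventually_lt_const hx
      filter_upwards [this] with y hy
      simp [truncate_apply, hη (a • y) (by simpa [norm_smul, abs_of_pos ha] using hy)]
    rw [(this.iteratedFDeriv ℝ n).eq_of_nhds]
    simpa using mul_nonneg ha.le hC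
  · have h1 : ‖iteratedFDeriv ℝ n (truncate η a f - f : 𝓢(E, F)) x‖ ≤
        ∑ i ∈ Finset.range (n + 1), (n.choose i : ℝ) * SchwartzMap.seminorm ℝ 0 i η *
          ‖iteratedFDeriv ℝ (n - i) f x‖ + ‖iteratedFDeriv ℝ n f x‖ := by
      have hs : ContDiff ℝ n (fun x => η (a • x)) :=
        (η.smooth (n : ℕ∞)).comp (contDiff_const_smul a)
      have e1 : ((truncate η a f - f : 𝓢(E, F)) : E → F) =
          (fun x => η (a • x) • f x) - f := by
        ext y; simp [truncate_apply]
      have hsf : ContDiff ℝ n (fun x => η (a • x) • f x) := hs.smul (f.smooth (n : ℕ∞))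
      rw [e1, iteratedFDeriv_sub_apply hsf.contDiffAt (f.smooth (n : ℕ∞)).contDiffAt]
      refine (norm_sub_le _ _).trans (add_le_add_left ?_ _)
      refine (norm_iteratedFDeriv_smul_le hs (f.smooth (n : ℕ∞)) x le_rfl).trans ?_
      refine Finset.sum_le_sum fun i hi => ?_
      gcongr
      rw [iteratedFDeriv_comp_const_smul a (η.smooth (i : ℕ∞)), norm_smul]
      refine le_trans ?_ (SchwartzMap.norm_iteratedFDeriv_le_seminorm ℝ η i (a • x))
      -- Each derivative of the dilated cutoff produces a factor `a`, and `a ≤ 1`.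
      refine mul_le_of_le_one_left (norm_nonneg _) ?_
      rw [norm_pow, Real.norm_of_nonneg ha.le]
      exact pow_le_one₀ ha.le ha1
    have h2 : ∀ m, ‖x‖ ^ k * ‖iteratedFDeriv ℝ m f x‖ ≤ a * p (k + 1) m := fun m => by
      calc ‖x‖ ^ k * ‖iteratedFDeriv ℝ m f x‖
          ≤ (a * ‖x‖) * (‖x‖ ^ k * ‖iteratedFDeriv ℝ m f x‖) :=
            le_mul_of_one_le_left (by positivity) hx
        _ = a * (‖x‖ ^ (k + 1) * ‖iteratedFDeriv ℝ m f x‖) := by ring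
        _ ≤ _ := by gcongr; exact SchwartzMap.le_seminorm ℝ (k + 1) m f x
    calc _ ≤ ‖x‖ ^ k * _ := mul_le_mul_of_nonneg_left h1 (by positivity)
      _ = ∑ i ∈ Finset.range (n + 1), (n.choose i : ℝ) * SchwartzMap.seminorm ℝ 0 i η *
          (‖x‖ ^ k * ‖iteratedFDeriv ℝ (n - i) f x‖) + ‖x‖ ^ k * ‖iteratedFDeriv ℝ n f x‖ := by
        rw [mul_add, Finset.mul_sum]; congr 1
        exact Finset.sum_congr rfl fun i _ => by ring
      _ ≤ ∑ i ∈ Finset.range (n + 1), (n.choose i : ℝ) * SchwartzMap.seminorm ℝ 0 i η *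
          (a * p (k + 1) (n - i)) + a * p (k + 1) n := by
        refine add_le_add (Finset.sum_le_sum fun i _ => ?_) (h2 _)
        exact mul_le_mul_of_nonneg_left (h2 _) (mul_nonneg (by positivity) (apply_nonneg _ _))
      _ = _ := by
        rw [mul_add, Finset.mul_sum]; congr 1
        exact Finset.sum_congr rfl fun i _ => by ring

/-- Compactly supported functions are sequentially dense in the Schwartz space. -/
theorem exists_tendsto_hasCompactSupport [FiniteDimensional ℝ E] (f : 𝓢(E, F)) :
    ∃ g : ℕ → 𝓢(E, F), (∀ n, HasCompactSupport (g n)) ∧ Tendsto g atTop (𝓝 f) := by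
  obtain ⟨b, hb⟩ : ∃ η : 𝓢(E, ℝ), HasCompactSupport η ∧ ∀ x, ‖x‖ < 1 → η x = 1 := by
    let b : ContDiffBump (0 : E) := ⟨1, 2, one_pos, one_lt_two⟩
    refine ⟨b.hasCompactSupport.toSchwartzMap b.contDiff, b.hasCompactSupport, fun x hx => ?_⟩
    exact b.one_of_mem_closedBall (by simpa using hx.le)
  refine ⟨fun n => truncate b (1 / ((n : ℝ) + 1)) f, fun n => ?_, ?_⟩
  · have ha : (1 / ((n : ℝ) + 1)) ≠ 0 := by positivity
    have : ((truncate b (1 / ((n : ℝ) + 1)) f : 𝓢(E, F)) : E → F) =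
      fun x => b ((1 / ((n : ℝ) + 1)) • x) • f x := by ext x; exact truncate_apply _ _ _ _
    rw [this]
    exact (hb.1.comp_homeomorph (Homeomorph.smulOfNeZero _ ha)).smul_right
  · rw [(schwartz_withSeminorms ℝ E F).tendsto_nhds _ f]
    rintro ⟨k, n⟩ ε hε
    obtain ⟨C, hC⟩ := seminorm_truncate_sub_le b hb.2 f k n
    have h0 : Tendsto (fun m : ℕ => (1 / ((m : ℝ) + 1)) * C) atTop (𝓝 0) := by
      simpa using tendsto_one_div_add_atTop_nhds_zero_nat.mul_const C
    filter_upwards [h0.eventually_lt_const hε] with m hm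
    refine lt_of_le_of_lt (hC _ (by positivity) ?_) hm
    rw [div_le_one (by positivity)]
    simp

end Density

/-! ### Real test functions against complex tempered distributions -/

/-- The complexification of a real Schwartz function. -/
noncomputable def complexify {E : Type*} [NormedAddCommGroup E] [NormedSpace ℝ E] (θ : 𝓢(E, ℝ)) :
    𝓢(E, ℂ) :=
  SchwartzMap.postcompCLM (𝕜 := ℝ) Complex.ofRealCLM θ

@[simp] lemma complexify_apply {E : Type*} [NormedAddCommGroup E] [NormedSpace ℝ E]
    (θ : 𝓢(E, ℝ)) (x : E) : complexify θ x = (θ x : ℂ) := rfl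

/-- A tempered distribution that vanishes on real test functions is zero. -/
theorem tempered_eq_zero {E F : Type*} [NormedAddCommGroup E] [NormedSpace ℝ E]
    [FiniteDimensional ℝ E] [NormedAddCommGroup F] [NormedSpace ℂ F] (T : 𝓢'(E, F))
    (h : ∀ θ : 𝓢(E, ℝ), HasCompactSupport θ → T (complexify θ) = 0) : T = 0 := by
  ext f
  obtain ⟨g, hg, hgf⟩ := exists_tendsto_hasCompactSupport f
  refine tendsto_nhds_unique ((T.continuous.tendsto f).comp hgf) ?_
  have : ∀ n, T (g n) = 0 := fun n => by
    have hre : HasCompactSupport (SchwartzMap.postcompCLM (𝕜 := ℝ) Complex.reCLM (g n)) :=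
      (hg n).comp_left (g := Complex.re) Complex.zero_re
    have him : HasCompactSupport (SchwartzMap.postcompCLM (𝕜 := ℝ) Complex.imCLM (g n)) :=
      (hg n).comp_left (g := Complex.im) Complex.zero_im
    have : g n = complexify (SchwartzMap.postcompCLM (𝕜 := ℝ) Complex.reCLM (g n)) +
        Complex.I • complexify (SchwartzMap.postcompCLM (𝕜 := ℝ) Complex.imCLM (g n)) := by
      ext x
      simp [mul_comm Complex.I]
    rw [this, map_add, map_smul, h _ hre, h _ him]
    simp
  exact tendsto_const_nhds.congr fun n => (this n).symm

/-- Line derivatives commute with continuous linear maps. -/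
lemma lineDeriv_postcomp {E F G : Type*} [NormedAddCommGroup E] [NormedSpace ℝ E]
    [NormedAddCommGroup F] [NormedSpace ℝ F] [NormedAddCommGroup G] [NormedSpace ℝ G]
    (L : F →L[ℝ] G) (m : E) (θ : 𝓢(E, F)) :
    ∂_{m} (SchwartzMap.postcompCLM (𝕜 := ℝ) L θ) = SchwartzMap.postcompCLM (𝕜 := ℝ) L (∂_{m} θ) := by
  ext x
  simp only [SchwartzMap.lineDerivOp_apply_eq_fderiv, SchwartzMap.postcompCLM_apply]
  have : ((SchwartzMap.postcompCLM (𝕜 := ℝ) L θ : 𝓢(E, G)) : E → G) = L ∘ θ := rfl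
  rw [this, fderiv_comp _ L.differentiableAt θ.differentiableAt]
  simp

lemma laplacian_postcomp {E F G : Type*} [NormedAddCommGroup E] [InnerProductSpace ℝ E]
    [FiniteDimensional ℝ E]
    [NormedAddCommGroup F] [NormedSpace ℝ F] [NormedAddCommGroup G] [NormedSpace ℝ G]
    (L : F →L[ℝ] G) (θ : 𝓢(E, F)) :
    Δ (SchwartzMap.postcompCLM (𝕜 := ℝ) L θ) = SchwartzMap.postcompCLM (𝕜 := ℝ) L (Δ θ) := by
  simp [SchwartzMap.laplacian_eq_sum (stdOrthonormalBasis ℝ E), lineDeriv_postcomp]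

lemma lineDeriv_lineDeriv_comm {E F : Type*} [NormedAddCommGroup E] [NormedSpace ℝ E]
    [NormedAddCommGroup F] [NormedSpace ℝ F] (m m' : E) (θ : 𝓢(E, F)) :
    ∂_{m} (∂_{m'} θ) = ∂_{m'} (∂_{m} θ) := by
  have key : ∀ m m' x, (∂_{m} (∂_{m'} θ)) x = fderiv ℝ (fderiv ℝ θ) x m m' := fun m m' x => by
    have e : ((∂_{m'} θ : 𝓢(E, F)) : E → F) = fun y => fderiv ℝ θ y m' := by
      ext y; exact SchwartzMap.lineDerivOp_apply_eq_fderiv _ _ _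
    rw [SchwartzMap.lineDerivOp_apply_eq_fderiv, e]
    have hd : DifferentiableAt ℝ (fderiv ℝ θ) x :=
      ((θ.smooth 2).fderiv_right (m := 1) le_rfl).differentiable one_ne_zero x
    rw [fderiv_clm_apply hd (differentiableAt_const _)]
    simp
  ext x
  rw [key, key]
  exact ((θ.smooth 2).contDiffAt.isSymmSndFDerivAt (by simp)) _ _

/-! ### Fourier transforms of real vector fields -/

/-- Complex three-space. -/
abbrev C3 := EuclideanSpace ℂ (Fin 3)

/-- Square-integrable complex vector fields. -/
noncomputable abbrev L2C := Lp C3 2 (volume : Measure R3)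

/-- The inclusion of `ℝ³` into `ℂ³`. -/
noncomputable def toC3 : R3 →ₗᵢ[ℝ] C3 where
  toFun x := WithLp.toLp 2 fun i => (x i : ℂ)
  map_add' x y := by ext i; simp
  map_smul' c x := by ext i; simp
  norm_map' x := by simp [EuclideanSpace.norm_eq]

@[simp] lemma toC3_apply (x : R3) (i : Fin 3) : toC3 x i = (x i : ℂ) := rfl

/-- The complexification of a real vector field. -/
noncomputable def cplx (p : ENNReal) [Fact (1 ≤ p)] :
    Lp R3 p (volume : Measure R3) →L[ℝ] Lp C3 p (volume : Measure R3) :=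
  toC3.toContinuousLinearMap.compLpL p volume

lemma coeFn_cplx (p : ENNReal) [Fact (1 ≤ p)] (f : Lp R3 p (volume : Measure R3)) :
    cplx p f =ᵐ[volume] fun x => toC3 (f x) :=
  toC3.toContinuousLinearMap.coeFn_compLpL f

/-- The Fourier transform of a real square-integrable vector field. -/
noncomputable def hat : L2 →L[ℝ] L2C :=
  ((Lp.fourierTransformₗᵢ R3 C3).toContinuousLinearEquiv.toContinuousLinearMap.restrictScalars ℝ).comp
    (cplx 2)

lemma hat_apply (f : L2) : hat f = 𝓕 (cplx 2 f) := rfl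

/-- The Fourier transform of a real integrable vector field. -/
noncomputable def hatL1 : Lp R3 1 (volume : Measure R3) →L[ℝ] BoundedContinuousFunction R3 C3 :=
  ((Real.Lp.fourierTransformCLM R3 C3).restrictScalars ℝ).comp (cplx 1)

lemma hatL1_apply (f : Lp R3 1 (volume : Measure R3)) (ξ : R3) :
    hatL1 f ξ = 𝓕 (cplx 1 f : R3 → C3) ξ := rfl

/-! ### Distributions given by functions, and their Fourier transforms -/

/-- The functional `T` on Schwartz functions is integration against the function `G`. -/
def Represents {V : Type*} [NormedAddCommGroup V] [NormedSpace ℂ V]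
    (T : 𝓢(R3, ℂ) → V) (G : R3 → V) : Prop :=
  ∀ ρ : 𝓢(R3, ℂ), Integrable (fun ξ => ρ ξ • G ξ) ∧ T ρ = ∫ ξ, ρ ξ • G ξ

namespace Represents

variable {V W : Type*} [NormedAddCommGroup V] [NormedSpace ℂ V]
  [NormedAddCommGroup W] [NormedSpace ℂ W]

lemma add {S T : 𝓢(R3, ℂ) → V} {F G : R3 → V} (hS : Represents S F) (hT : Represents T G) :
    Represents (fun ρ => S ρ + T ρ) (fun ξ => F ξ + G ξ) := fun ρ => by
  simp only [smul_add]
  exact ⟨(hS ρ).1.add (hT ρ).1, by rw [integral_add (hS ρ).1 (hT ρ).1, (hS ρ).2, (hT ρ).2]⟩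

lemma const_smul {T : 𝓢(R3, ℂ) → V} {G : R3 → V} (c : ℂ) (hT : Represents T G) :
    Represents (fun ρ => c • T ρ) (fun ξ => c • G ξ) := fun ρ => by
  simp only [smul_comm _ c]
  exact ⟨(hT ρ).1.smul c, by rw [integral_smul, (hT ρ).2]⟩

lemma sub {S T : 𝓢(R3, ℂ) → V} {F G : R3 → V} (hS : Represents S F) (hT : Represents T G) :
    Represents (fun ρ => S ρ - T ρ) (fun ξ => F ξ - G ξ) := fun ρ => by
  simp only [smul_sub]
  exact ⟨(hS ρ).1.sub (hT ρ).1, by rw [integral_sub (hS ρ).1 (hT ρ).1, (hS ρ).2, (hT ρ).2]⟩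

lemma sum {ι : Type*} (s : Finset ι) {T : ι → 𝓢(R3, ℂ) → V} {G : ι → R3 → V}
    (hT : ∀ i, Represents (T i) (G i)) :
    Represents (fun ρ => ∑ i ∈ s, T i ρ) (fun ξ => ∑ i ∈ s, G i ξ) := fun ρ => by
  simp only [Finset.smul_sum]
  refine ⟨integrable_finsetSum _ fun i _ => (hT i ρ).1, ?_⟩
  rw [integral_finsetSum _ fun i _ => (hT i ρ).1]
  exact Finset.sum_congr rfl fun i _ => (hT i ρ).2

lemma comp [CompleteSpace V] [CompleteSpace W] {T : 𝓢(R3, ℂ) → V} {G : R3 → V}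
    (hT : Represents T G) (L : V →L[ℂ] W) :
    Represents (fun ρ => L (T ρ)) (fun ξ => L (G ξ)) := fun ρ => by
  have e : (fun ξ => ρ ξ • L (G ξ)) = fun ξ => L (ρ ξ • G ξ) := by ext ξ; simp
  rw [e]
  exact ⟨L.integrable_comp (hT ρ).1, by rw [L.integral_comp_comm (hT ρ).1, ← (hT ρ).2]⟩

lemma ae_eq_zero [CompleteSpace V] {T : 𝓢(R3, ℂ) → V} {G : R3 → V} (hT : Represents T G)
    (h : ∀ ρ, T ρ = 0) : ∀ᵐ ξ, G ξ = 0 := by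
  have key : ∀ g : R3 → ℝ, ContDiff ℝ ∞ g → HasCompactSupport g →
      Integrable (fun x => g x • G x) ∧ ∫ x, g x • G x = 0 := fun g hg hg' => by
    have := hT (complexify (hg'.toSchwartzMap hg))
    simp only [complexify_apply, HasCompactSupport.toSchwartzMap_toFun,
      Complex.coe_smul, h] at this
    exact ⟨this.1, this.2.symm⟩
  refine ae_eq_zero_of_integral_contDiff_smul_eq_zero ?_ fun g hg hg' => (key g hg hg').2
  refine (locallyIntegrable_iff).2 fun K hK => ?_
  obtain ⟨r, hr, hKr⟩ := hK.isBounded.subset_closedBall_lt 0 0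
  -- A bump equal to `1` on `K` reduces local integrability of `G` to the integrability built into
  -- `Represents`.
  let b : ContDiffBump (0 : R3) := ⟨r, r + 1, hr, by linarith⟩
  refine ((key b b.contDiff b.hasCompactSupport).1.integrableOn (s := K)).congr_fun (fun x hx => ?_)
    hK.measurableSet
  simp [b.one_of_mem_closedBall (hKr hx)]

lemma ae_eq [CompleteSpace V] {T : 𝓢(R3, ℂ) → V} {F G : R3 → V} (hF : Represents T F)
    (hG : Represents T G) : F =ᵐ[volume] G := by
  filter_upwards [(hF.sub hG).ae_eq_zero (by simp)] with ξ hξ using sub_eq_zero.1 hξ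

lemma of_Lp [CompleteSpace V] {p : ENNReal} [hp : Fact (1 ≤ p)]
    (f : Lp V p (volume : Measure R3)) :
    Represents (Lp.toTemperedDistribution f : 𝓢'(R3, V)) f := fun ρ => by
  refine ⟨?_, Lp.toTemperedDistribution_apply f ρ⟩
  have := ENNReal.HolderConjugate.inv_one_sub_inv' hp.out
  exact memLp_one_iff_integrable.1 ((Lp.memLp f).smul (ρ.memLp (1 - p⁻¹)⁻¹))

lemma fourier_L2 (f : L2C) : Represents (𝓕 (Lp.toTemperedDistribution f : 𝓢'(R3, C3)) : 𝓢'(R3, C3))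
    (𝓕 f : L2C) := by
  rw [Lp.fourier_toTemperedDistribution_eq]
  exact of_Lp _

lemma fourierInv_L2 (f : L2C) : Represents (𝓕⁻ (Lp.toTemperedDistribution f : 𝓢'(R3, C3)) : 𝓢'(R3, C3))
    (𝓕⁻ f : L2C) := by
  rw [Lp.fourierInv_toTemperedDistribution_eq]
  exact of_Lp _

lemma of_bounded {G : R3 → V} (hG : AEStronglyMeasurable G) (C : ℝ) (hC : ∀ ξ, ‖G ξ‖ ≤ C) :
    Represents (fun ρ => ∫ ξ, ρ ξ • G ξ) G := fun ρ =>
  ⟨(ρ.integrable (μ := volume)).smul_bdd C hG (.of_forall hC), rfl⟩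

/-- Fubini moves the transform from the Schwartz function to `f`; the transform of `f` is bounded,
so it pairs with every Schwartz function. -/
lemma fourier_L1 [CompleteSpace V] (f : Lp V 1 (volume : Measure R3)) :
    Represents (𝓕 (Lp.toTemperedDistribution f : 𝓢'(R3, V)) : 𝓢'(R3, V)) (𝓕 (f : R3 → V)) := by
  have hf := L1.integrable_coeFn f
  have := of_bounded (Real.Lp.fourierTransform f).continuous.aestronglyMeasurable _
    (Real.Lp.fourierTransform f).norm_coe_le_norm
  refine fun ρ => ⟨(this ρ).1, ?_⟩
  rw [TemperedDistribution.fourier_apply, Lp.toTemperedDistribution_apply, SchwartzMap.fourier_coe]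
  simpa using! VectorFourier.integral_fourierIntegral_smul_eq_flip (L := innerₗ R3)
    Real.continuous_fourierChar continuous_inner (ρ.integrable (μ := volume)) hf

lemma fourierInv_L1 [CompleteSpace V] (f : Lp V 1 (volume : Measure R3)) :
    Represents (𝓕⁻ (Lp.toTemperedDistribution f : 𝓢'(R3, V)) : 𝓢'(R3, V)) (𝓕⁻ (f : R3 → V)) := by
  have hf := L1.integrable_coeFn f
  have := of_bounded (Real.Lp.fourierTransformInv f).continuous.aestronglyMeasurable _
    (Real.Lp.fourierTransformInv f).norm_coe_le_norm
  rw [Real.Lp.coe_fourierTransformInv] at this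
  refine fun ρ => ⟨(this ρ).1, ?_⟩
  rw [TemperedDistribution.fourierInv_apply, Lp.toTemperedDistribution_apply,
    SchwartzMap.fourierInv_coe]
  have h := VectorFourier.integral_fourierIntegral_smul_eq_flip (L := -innerₗ R3)
    Real.continuous_fourierChar continuous_inner.neg (ρ.integrable (μ := volume)) hf
  -- The inverse transform has phase form `-⟨x, ξ⟩`, which is symmetric, so the transform it induces
  -- on `f` is again the inverse one.
  have e : (-innerₗ R3).flip = -innerₗ R3 := by
    ext x y; simp [real_inner_comm]
  rw [e] at h
  exact h

lemma fourier_lineDeriv {T : 𝓢'(R3, V)} {G : R3 → V} (hT : Represents (𝓕 T : 𝓢'(R3, V)) G) (m : R3) :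
    Represents (𝓕 (∂_{m} T : 𝓢'(R3, V)) : 𝓢'(R3, V)) fun ξ => (2 * Real.pi * Complex.I * (inner ℝ ξ m : ℝ) : ℂ) • G ξ := by
  have hm : (fun ξ : R3 => (inner ℝ ξ m : ℝ)).HasTemperateGrowth := by fun_prop
  have hm' : (fun ξ : R3 => ((inner ℝ ξ m : ℝ) : ℂ)).HasTemperateGrowth := by fun_prop
  intro ρ
  have := hT (SchwartzMap.smulLeftCLM ℂ (fun ξ : R3 => (inner ℝ ξ m : ℂ)) ρ)
  simp only [SchwartzMap.smulLeftCLM_apply_apply hm', smul_eq_mul] at this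
  have e : (fun ξ => ρ ξ • (2 * Real.pi * Complex.I * (inner ℝ ξ m : ℝ) : ℂ) • G ξ) = fun ξ =>
      (2 * Real.pi * Complex.I : ℂ) • (((inner ℝ ξ m : ℝ) : ℂ) * ρ ξ) • G ξ := by
    ext ξ; simp only [smul_smul]; congr 1; ring
  rw [e]
  refine ⟨this.1.smul _, ?_⟩
  rw [integral_smul, TemperedDistribution.fourier_lineDerivOp_eq, ← this.2]
  rfl

lemma fourier_laplacian {T : 𝓢'(R3, V)} {G : R3 → V} (hT : Represents (𝓕 T : 𝓢'(R3, V)) G) :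
    Represents (𝓕 (Δ T : 𝓢'(R3, V)) : 𝓢'(R3, V)) fun ξ => (-(4 * Real.pi ^ 2 * ‖ξ‖ ^ 2 : ℝ) : ℂ) • G ξ := by
  have h : ∀ i, Represents (𝓕 (∂_{EuclideanSpace.basisFun (Fin 3) ℝ i}
      (∂_{EuclideanSpace.basisFun (Fin 3) ℝ i} T : 𝓢'(R3, V)) : 𝓢'(R3, V)) : 𝓢'(R3, V)) _ := fun i =>
    (hT.fourier_lineDeriv (EuclideanSpace.basisFun (Fin 3) ℝ i)).fourier_lineDeriv
      (EuclideanSpace.basisFun (Fin 3) ℝ i)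
  have := sum Finset.univ h
  convert! this using 1
  · rw [TemperedDistribution.laplacian_eq_sum (EuclideanSpace.basisFun (Fin 3) ℝ)]
    ext ρ
    simp only [TemperedDistribution.fourier_apply]
    simp
  · ext1 ξ
    simp only [smul_smul, ← Finset.sum_smul]
    congr 1
    simp only [EuclideanSpace.basisFun_apply, EuclideanSpace.inner_single_right,
      EuclideanSpace.norm_sq_eq, Fin.sum_univ_three, Real.norm_eq_abs, sq_abs]
    push_cast
    simp
    ring_nf
    simp only [Complex.I_sq]
    ring

end Represents

/-! ### Weak derivatives and divergence in frequency space -/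

/-- The distribution defined by a real vector field. -/
noncomputable def dist {p : ENNReal} [Fact (1 ≤ p)] (f : Lp R3 p (volume : Measure R3)) :
    𝓢'(R3, C3) :=
  Lp.toTemperedDistribution (cplx p f)

lemma dist_complexify {p : ENNReal} [Fact (1 ≤ p)] (f : Lp R3 p (volume : Measure R3))
    (θ : 𝓢(R3, ℝ)) : dist f (complexify θ) = toC3 (∫ x, θ x • f x) := by
  rw [dist, Lp.toTemperedDistribution_apply, ← toC3.integral_comp_comm]
  refine integral_congr_ae ?_
  filter_upwards [coeFn_cplx p f] with x hx
  rw [hx, map_smul, complexify_apply, Complex.coe_smul]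

lemma lineDeriv_complexify (m : R3) (θ : 𝓢(R3, ℝ)) :
    ∂_{m} (complexify θ) = complexify (∂_{m} θ) :=
  lineDeriv_postcomp _ m θ

lemma laplacian_complexify (θ : 𝓢(R3, ℝ)) : Δ (complexify θ) = complexify (Δ θ) :=
  laplacian_postcomp _ θ

lemma lineDeriv_dist_complexify {p : ENNReal} [Fact (1 ≤ p)] (f : Lp R3 p (volume : Measure R3))
    (m : R3) (θ : 𝓢(R3, ℝ)) :
    (∂_{m} (dist f) : 𝓢'(R3, C3)) (complexify θ) = -toC3 (∫ x, (∂_{m} θ : 𝓢(R3, ℝ)) x • f x) := by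
  rw [TemperedDistribution.lineDerivOp_apply_apply, map_neg, lineDeriv_complexify, dist_complexify]

lemma isTest_of_hasCompactSupport {F : Type*} [NormedAddCommGroup F] [NormedSpace ℝ F]
    (θ : 𝓢(R3, F)) (h : HasCompactSupport θ) : IsTest θ :=
  ⟨θ.smooth ⊤, h⟩

lemma represents_fourier_dist (f : L2) : Represents (𝓕 (dist f) : 𝓢'(R3, C3)) (hat f) :=
  Represents.fourier_L2 _

lemma represents_fourier_dist_L1 (f : Lp R3 1 (volume : Measure R3)) :
    Represents (𝓕 (dist f) : 𝓢'(R3, C3)) (hatL1 f) :=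
  Represents.fourier_L1 _

lemma inner_e (ξ : R3) (i : Fin 3) : inner ℝ ξ (e i) = ξ i := by
  simp [e, EuclideanSpace.inner_single_right]

/-- The Fourier transform of a weak partial derivative. -/
theorem hat_of_isWeakPartial {i : Fin 3} {f g : L2} (h : IsWeakPartial i f g) :
    ∀ᵐ ξ, hat g ξ = (2 * Real.pi * Complex.I * (ξ i : ℝ) : ℂ) • hat f ξ := by
  have key : (∂_{e i} (dist f) : 𝓢'(R3, C3)) = dist g := by
    rw [← sub_eq_zero]
    refine tempered_eq_zero _ fun θ hθ => ?_
    have := h θ (isTest_of_hasCompactSupport θ hθ)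
    change (∂_{e i} (dist f) : 𝓢'(R3, C3)) (complexify θ) - dist g (complexify θ) = 0
    rw [lineDeriv_dist_complexify, dist_complexify]
    simp only [SchwartzMap.lineDerivOp_apply_eq_fderiv, this]
    simp
  have h1 := (represents_fourier_dist f).fourier_lineDeriv (e i)
  rw [key] at h1
  simp only [inner_e] at h1
  exact (represents_fourier_dist g).ae_eq h1

/-- The `j`-th coordinate of a distribution. -/
noncomputable def coord (j : Fin 3) (T : 𝓢'(R3, C3)) : 𝓢'(R3, ℂ) :=
  PointwiseConvergenceCLM.postcomp _ (EuclideanSpace.proj j : C3 →L[ℂ] ℂ) T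

lemma coord_apply (j : Fin 3) (T : 𝓢'(R3, C3)) (ρ : 𝓢(R3, ℂ)) : coord j T ρ = T ρ j := rfl

lemma integral_smul_apply {p : ENNReal} [Fact (1 ≤ p)] (f : Lp R3 p (volume : Measure R3))
    (θ : 𝓢(R3, ℝ)) (j : Fin 3) : (∫ x, θ x • f x) j = ∫ x, θ x * f x j := by
  have hp := ENNReal.HolderConjugate.inv_one_sub_inv' (Fact.out : 1 ≤ p)
  have hi : Integrable (fun x => θ x • f x) :=
    memLp_one_iff_integrable.1 ((Lp.memLp f).smul (θ.memLp (1 - p⁻¹)⁻¹))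
  exact ((EuclideanSpace.proj j : R3 →L[ℝ] ℝ).integral_comp_comm hi).symm

lemma integrable_smul_apply {p : ENNReal} [Fact (1 ≤ p)] (f : Lp R3 p (volume : Measure R3))
    (θ : 𝓢(R3, ℝ)) (j : Fin 3) : Integrable (fun x => θ x * f x j) := by
  have hp := ENNReal.HolderConjugate.inv_one_sub_inv' (Fact.out : 1 ≤ p)
  have hi : Integrable (fun x => θ x • f x) :=
    memLp_one_iff_integrable.1 ((Lp.memLp f).smul (θ.memLp (1 - p⁻¹)⁻¹))
  exact (EuclideanSpace.proj j : R3 →L[ℝ] ℝ).integrable_comp hi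

lemma inner_gradient (θ : 𝓢(R3, ℝ)) (x v : R3) :
    inner ℝ v (∇ θ x) = ∑ j, (∂_{e j} θ : 𝓢(R3, ℝ)) x * v j := by
  rw [real_inner_comm, gradient, InnerProductSpace.toDual_symm_apply]
  have hv : v = ∑ j, v j • e j := by
    ext i
    simp [e, Finset.sum_apply, Pi.single_apply]
  conv_lhs => rw [hv]
  simp [SchwartzMap.lineDerivOp_apply_eq_fderiv, mul_comm]

/-- The Fourier transform of a divergence-free field is orthogonal to the frequency. -/
theorem hat_of_divFree {w : L2} (h : DivFree w) : ∀ᵐ ξ, ∑ j, (ξ j : ℂ) * hat w ξ j = 0 := by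
  have key : ∑ j, coord j (∂_{e j} (dist w) : 𝓢'(R3, C3)) = 0 := by
    refine tempered_eq_zero _ fun θ hθ => ?_
    have := h θ (isTest_of_hasCompactSupport θ hθ)
    simp only [inner_gradient] at this
    rw [integral_finsetSum _ fun j _ => integrable_smul_apply w _ j] at this
    have e1 : (∑ j, coord j (∂_{e j} (dist w) : 𝓢'(R3, C3))) (complexify θ) =
        ∑ j, (∂_{e j} (dist w) : 𝓢'(R3, C3)) (complexify θ) j := by
      simp [coord_apply]
    rw [e1]
    simp only [lineDeriv_dist_complexify]
    simp only [PiLp.neg_apply, toC3_apply, integral_smul_apply]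
    rw [Finset.sum_neg_distrib, ← Complex.ofReal_sum, this]
    simp
  have h1 := Represents.sum Finset.univ fun j =>
    ((represents_fourier_dist w).fourier_lineDeriv (e j)).comp (EuclideanSpace.proj j : C3 →L[ℂ] ℂ)
  have h2 := h1.ae_eq_zero fun ρ => by
    have := congrArg (fun T : 𝓢'(R3, ℂ) => T (𝓕 ρ)) key
    simpa [coord_apply] using this
  filter_upwards [h2] with ξ hξ
  have h3 : (2 * Real.pi * Complex.I : ℂ) * ∑ j, (ξ j : ℂ) * hat w ξ j = 0 := by
    rw [← hξ, Finset.mul_sum]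
    refine Finset.sum_congr rfl fun j _ => ?_
    simp [inner_e, mul_assoc]
  simpa [Real.pi_ne_zero] using h3

/-! ### Elimination of the pressure -/

/-- The weak momentum balance `d = νΔU - ∑ᵢ ∂ᵢQᵢ + ∇p`, tested against solenoidal fields. -/
def MomentumBalance (ν : ℝ) (d U : L2) (Q : Fin 3 → Lp R3 1 (volume : Measure R3)) : Prop :=
  ∀ φ : 𝓢(R3, R3), HasCompactSupport φ → (∀ x, ∑ i, (∂_{e i} φ : 𝓢(R3, R3)) x i = 0) →
    ∫ x, inner ℝ (d x) (φ x) = ν * (∫ x, inner ℝ (U x) ((Δ φ : 𝓢(R3, R3)) x)) +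
      ∑ i, ∫ x, inner ℝ (Q i x) ((∂_{e i} φ : 𝓢(R3, R3)) x)

/-- The field `θ e_b`. -/
noncomputable def field (b : Fin 3) (θ : 𝓢(R3, ℝ)) : 𝓢(R3, R3) :=
  SchwartzMap.postcompCLM (𝕜 := ℝ) (ContinuousLinearMap.toSpanSingleton ℝ (e b)) θ

lemma field_apply (b : Fin 3) (θ : 𝓢(R3, ℝ)) (x : R3) : field b θ x = θ x • e b := by
  simp [field]

lemma lineDeriv_field (m : R3) (b : Fin 3) (θ : 𝓢(R3, ℝ)) :
    ∂_{m} (field b θ) = field b (∂_{m} θ) := lineDeriv_postcomp _ _ _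

lemma laplacian_field (b : Fin 3) (θ : 𝓢(R3, ℝ)) : Δ (field b θ) = field b (Δ θ) :=
  laplacian_postcomp _ _

lemma inner_field (b : Fin 3) (θ : 𝓢(R3, ℝ)) (v x : R3) :
    inner ℝ v (field b θ x) = θ x * v b := by
  rw [field_apply, inner_smul_right, inner_e]

lemma integral_inner_field_sub {p : ENNReal} [Fact (1 ≤ p)] (f : Lp R3 p (volume : Measure R3))
    (a b : Fin 3) (θ η : 𝓢(R3, ℝ)) :
    ∫ x, inner ℝ (f x) ((field b θ - field a η : 𝓢(R3, R3)) x) =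
      (∫ x, θ x * f x b) - ∫ x, η x * f x a := by
  simp only [sub_apply, inner_sub_right, inner_field]
  exact integral_sub (integrable_smul_apply f θ b) (integrable_smul_apply f η a)

/-- The Fourier transform of `d - νΔU + ∑ᵢ ∂ᵢQᵢ`. -/
noncomputable def momentumSymbol (ν : ℝ) (d U : L2) (Q : Fin 3 → Lp R3 1 (volume : Measure R3))
    (ξ : R3) : C3 :=
  hat d ξ - (ν : ℂ) • (-(4 * Real.pi ^ 2 * ‖ξ‖ ^ 2 : ℝ) : ℂ) • hat U ξ +
    ∑ i, (2 * Real.pi * Complex.I * (ξ i : ℝ) : ℂ) • hatL1 (Q i) ξ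

/-- The distribution `d - νΔU + ∑ᵢ ∂ᵢQᵢ`. -/
noncomputable def momentumDist (ν : ℝ) (d U : L2) (Q : Fin 3 → Lp R3 1 (volume : Measure R3)) :
    𝓢'(R3, C3) :=
  dist d - (ν : ℂ) • (Δ (dist U) : 𝓢'(R3, C3)) + ∑ i, (∂_{e i} (dist (Q i)) : 𝓢'(R3, C3))

lemma momentumDist_apply (ν : ℝ) (d U : L2) (Q : Fin 3 → Lp R3 1 (volume : Measure R3))
    (ρ : 𝓢(R3, ℂ)) : momentumDist ν d U Q ρ =
      dist d ρ - (ν : ℂ) • (Δ (dist U) : 𝓢'(R3, C3)) ρ +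
        ∑ i, (∂_{e i} (dist (Q i)) : 𝓢'(R3, C3)) ρ := by
  simp [momentumDist]

lemma represents_momentum (ν : ℝ) (d U : L2) (Q : Fin 3 → Lp R3 1 (volume : Measure R3)) :
    Represents (𝓕 (momentumDist ν d U Q) : 𝓢'(R3, C3)) (momentumSymbol ν d U Q) := by
  have h1 := ((represents_fourier_dist d).sub
    ((represents_fourier_dist U).fourier_laplacian.const_smul (ν : ℂ))).add
    (Represents.sum Finset.univ fun i =>
      (represents_fourier_dist_L1 (Q i)).fourier_lineDeriv (e i))
  simp only [inner_e] at h1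
  exact fun ρ => ⟨(h1 ρ).1, (momentumDist_apply ν d U Q _).trans (h1 ρ).2⟩

lemma momentumDist_complexify (ν : ℝ) (d U : L2) (Q : Fin 3 → Lp R3 1 (volume : Measure R3))
    (θ : 𝓢(R3, ℝ)) (b : Fin 3) : momentumDist ν d U Q (complexify θ) b =
      (((∫ x, θ x * d x b) - ν * (∫ x, (Δ θ : 𝓢(R3, ℝ)) x * U x b) -
        ∑ i, ∫ x, (∂_{e i} θ : 𝓢(R3, ℝ)) x * Q i x b : ℝ) : ℂ) := by
  rw [momentumDist_apply, TemperedDistribution.laplacian_apply_apply, laplacian_complexify]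
  simp only [lineDeriv_dist_complexify, dist_complexify]
  simp [integral_smul_apply, sub_eq_add_neg]

/-- The fields `∂ₐθ e_b - ∂_bθ eₐ` are admissible test fields, and testing with them says exactly
that the curl of the residual vanishes as a distribution. -/
theorem momentumSymbol_curl_free {ν : ℝ} {d U : L2} {Q : Fin 3 → Lp R3 1 (volume : Measure R3)}
    (h : MomentumBalance ν d U Q) (a b : Fin 3) :
    ∀ᵐ ξ, (ξ a : ℂ) * momentumSymbol ν d U Q ξ b = (ξ b : ℂ) * momentumSymbol ν d U Q ξ a := by
  set D := momentumDist ν d U Q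
  have key : coord b (∂_{e a} D : 𝓢'(R3, C3)) - coord a (∂_{e b} D : 𝓢'(R3, C3)) = 0 := by
    refine tempered_eq_zero _ fun θ hθ => ?_
    have hcs : ∀ m : R3, HasCompactSupport (∂_{m} θ : 𝓢(R3, ℝ)) := fun m =>
      hθ.of_isClosed_subset (isClosed_tsupport _) (SchwartzMap.tsupport_lineDerivOp_subset m θ)
    have e2 : ∀ i, (∂_{e i} (field b (∂_{e a} θ) - field a (∂_{e b} θ)) : 𝓢(R3, R3)) =
        field b (∂_{e i} (∂_{e a} θ)) - field a (∂_{e i} (∂_{e b} θ)) := fun i => by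
      rw [← lineDeriv_field (e i) b (∂_{e a} θ), ← lineDeriv_field (e i) a (∂_{e b} θ)]
      exact map_sub (LineDeriv.lineDerivOpCLM ℝ 𝓢(R3, R3) (e i)) _ _
    -- The two deferred goals are compact support and zero divergence; the latter is the symmetry of
    -- second derivatives.
    have hφ := h (field b (∂_{e a} θ) - field a (∂_{e b} θ)) ?_ ?_
    · change (∂_{e a} D : 𝓢'(R3, C3)) (complexify θ) b -
        (∂_{e b} D : 𝓢'(R3, C3)) (complexify θ) a = 0
      simp only [TemperedDistribution.lineDerivOp_apply_apply, map_neg, lineDeriv_complexify,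
        PiLp.neg_apply]
      simp only [D, momentumDist_complexify]
      have e1 : (Δ (field b (∂_{e a} θ) - field a (∂_{e b} θ)) : 𝓢(R3, R3)) =
          field b (Δ (∂_{e a} θ)) - field a (Δ (∂_{e b} θ)) := by
        rw [← laplacian_field, ← laplacian_field]
        exact map_sub (LineDeriv.laplacianCLM ℝ R3 𝓢(R3, R3)) _ _
      rw [e1] at hφ
      simp only [e2, integral_inner_field_sub, Finset.sum_sub_distrib] at hφ
      rw [← Complex.ofReal_neg, ← Complex.ofReal_neg, ← Complex.ofReal_sub]
      norm_cast
      linarith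
    · have e3 : ∀ c (η : 𝓢(R3, ℝ)), HasCompactSupport η → HasCompactSupport (field c η) :=
        fun c η hη => by
          have : (field c η : R3 → R3) = (fun r : ℝ => r • e c) ∘ η := by
            ext1 x; exact field_apply c η x
          rw [this]
          exact hη.comp_left (by simp)
      have := (e3 b _ (hcs (e a))).add (e3 a _ (hcs (e b))).neg
      simpa [sub_eq_add_neg] using! this
    · intro x
      simp only [e2, sub_apply, field_apply, PiLp.sub_apply, PiLp.smul_apply]
      simp only [e, PiLp.single_apply, Finset.sum_sub_distrib, smul_eq_mul]
      simp only [mul_ite, mul_one, mul_zero, Finset.sum_ite_eq', Finset.mem_univ,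
        if_true]
      rw [lineDeriv_lineDeriv_comm, sub_self]
  have hD := represents_momentum ν d U Q
  have h1 := ((hD.fourier_lineDeriv (e a)).comp (EuclideanSpace.proj b : C3 →L[ℂ] ℂ)).sub
    ((hD.fourier_lineDeriv (e b)).comp (EuclideanSpace.proj a : C3 →L[ℂ] ℂ))
  have h2 := h1.ae_eq_zero fun ρ => congrArg (fun T : 𝓢'(R3, ℂ) => T (𝓕 ρ)) key
  filter_upwards [h2] with ξ hξ
  simp only [inner_e, map_smul, PiLp.proj_apply, smul_eq_mul] at hξ
  have h3 : (2 * Real.pi * Complex.I : ℂ) * ((ξ a : ℂ) * momentumSymbol ν d U Q ξ b -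
      (ξ b : ℂ) * momentumSymbol ν d U Q ξ a) = 0 := by
    rw [← hξ]; ring
  simpa [Real.pi_ne_zero, sub_eq_zero] using h3

/-- Divergence-free fields are orthogonal to gradients, frequency by frequency. -/
theorem inner_hat_momentumSymbol {ν : ℝ} {d U : L2} {Q : Fin 3 → Lp R3 1 (volume : Measure R3)}
    (h : MomentumBalance ν d U Q) {w : L2} (hw : DivFree w) :
    ∀ᵐ ξ, inner ℂ (hat w ξ) (momentumSymbol ν d U Q ξ) = 0 := by
  have h1 : ∀ᵐ ξ, ∀ a b, (ξ a : ℂ) * momentumSymbol ν d U Q ξ b =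
      (ξ b : ℂ) * momentumSymbol ν d U Q ξ a :=
    ae_all_iff.2 fun a => ae_all_iff.2 fun b => momentumSymbol_curl_free h a b
  have h0 : ∀ᵐ ξ : R3, ξ ≠ 0 := by simp [ae_iff, measure_singleton]
  filter_upwards [h1, h0, hat_of_divFree hw] with ξ h1 h0 h2
  obtain ⟨a, ha⟩ : ∃ a, ξ a ≠ 0 := by
    by_contra! hc
    exact h0 (by ext i; simpa using hc i)
  have ha' : (ξ a : ℂ) ≠ 0 := by exact_mod_cast ha
  have h3 : ∑ j, (ξ j : ℂ) * (starRingEnd ℂ) (hat w ξ j) = 0 := by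
    simpa using congrArg (starRingEnd ℂ) h2
  -- Multiplying by `ξ a ≠ 0` and using curl-freeness factors out the `a`-th component of the
  -- symbol, leaving the conjugate of `ξ · hat w = 0`.
  have h4 : (ξ a : ℂ) * inner ℂ (hat w ξ) (momentumSymbol ν d U Q ξ) =
      momentumSymbol ν d U Q ξ a * ∑ j, (ξ j : ℂ) * (starRingEnd ℂ) (hat w ξ j) := by
    rw [PiLp.inner_apply, Finset.mul_sum, Finset.mul_sum]
    refine Finset.sum_congr rfl fun j _ => ?_
    rw [RCLike.inner_apply]
    linear_combination (starRingEnd ℂ) (hat w ξ j) * h1 a j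
  rw [h3, mul_zero] at h4
  exact (mul_eq_zero.1 h4).resolve_left ha'

/-! ### Energy growth for weakly solved evolution equations -/

/-- A function whose increments are bounded below by a quadratic is nondecreasing. -/
lemma le_of_quadratic_increments {F : ℝ → ℝ} {a b C : ℝ} (hab : a ≤ b)
    (hF : ∀ s t, a ≤ s → s ≤ t → t ≤ b → -(C * (t - s) ^ 2) ≤ F t - F s) : F a ≤ F b := by
  -- Cutting `[a, b]` into `n + 1` equal steps leaves a total error `C(b - a)²/(n + 1)`.
  have key : ∀ n : ℕ, -(C * (b - a) ^ 2 * (1 / ((n : ℝ) + 1))) ≤ F b - F a := fun n => by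
    have hn : (0 : ℝ) < (n : ℝ) + 1 := by positivity
    set h := (b - a) / ((n : ℝ) + 1)
    have hh : 0 ≤ h := div_nonneg (by linarith) hn.le
    have hb : a + ((n : ℝ) + 1) * h = b := by simp only [h]; field_simp; ring
    have h1 := Finset.sum_range_sub (fun k : ℕ => F (a + k * h)) (n + 1)
    have h2 : ∑ k ∈ Finset.range (n + 1), -(C * h ^ 2) ≤
        ∑ k ∈ Finset.range (n + 1), (F (a + (k + 1 : ℕ) * h) - F (a + k * h)) := by
      refine Finset.sum_le_sum fun k hk => ?_
      have hk' : ((k : ℝ) + 1) ≤ (n : ℝ) + 1 := by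
        have := Finset.mem_range.1 hk
        exact_mod_cast this
      have := hF (a + k * h) (a + (k + 1 : ℕ) * h) (by nlinarith [(Nat.cast_nonneg k : (0:ℝ) ≤ k)])
        (by push_cast; nlinarith) (by push_cast; nlinarith)
      have e : a + ((k + 1 : ℕ) : ℝ) * h - (a + k * h) = h := by push_cast; ring
      rwa [e] at this
    rw [h1] at h2
    simp only [Finset.sum_const, Finset.card_range, nsmul_eq_mul, Nat.cast_zero, zero_mul,
      add_zero] at h2
    push_cast at h2
    rw [hb] at h2
    refine le_trans (le_of_eq ?_) h2
    simp only [h]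
    field_simp
  have h0 : Tendsto (fun n : ℕ => -(C * (b - a) ^ 2 * (1 / ((n : ℝ) + 1)))) atTop (𝓝 0) := by
    simpa using (tendsto_one_div_add_atTop_nhds_zero_nat (𝕜 := ℝ)).const_mul (C * (b - a) ^ 2) |>.neg
  have := le_of_tendsto' h0 key
  linarith

/-- Energy growth for a curve in a Hilbert space that solves `X' = N` weakly against its own
values. -/
theorem energy_growth {E : Type*} [NormedAddCommGroup E] [InnerProductSpace ℂ E] {X N : ℝ → E}
    {g : ℝ → ℝ} {a b C : ℝ} (hab : a ≤ b) (hC : ∀ τ ∈ Icc a b, ‖N τ‖ ≤ C)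
    (hint : ∀ r ∈ Icc a b, IntervalIntegrable (fun τ => (inner ℂ (X r) (N τ)).re) volume a b)
    (hX : ∀ r ∈ Icc a b, ∀ s t, a ≤ s → s ≤ t → t ≤ b →
      (inner ℂ (X r) (X t - X s)).re = ∫ τ in s..t, (inner ℂ (X r) (N τ)).re)
    (hg : IntervalIntegrable g volume a b)
    (hgN : ∀ᵐ τ ∂(volume.restrict (Icc a b)), g τ ≤ (inner ℂ (X τ) (N τ)).re) :
    2 * ∫ τ in a..b, g τ ≤ ‖X b‖ ^ 2 - ‖X a‖ ^ 2 := by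
  have hC0 : 0 ≤ C := (norm_nonneg _).trans (hC a (left_mem_Icc.2 hab))
  have hsub : ∀ s t, a ≤ s → s ≤ t → t ≤ b → ∀ {f : ℝ → ℝ}, IntervalIntegrable f volume a b →
      IntervalIntegrable f volume s t := fun s t hs hst ht f hf =>
    hf.mono_set (by rw [uIcc_of_le hst, uIcc_of_le hab]; exact Icc_subset_Icc hs ht)
  -- Testing with `X t` and with `X s` and subtracting gives `‖X t - X s‖² = ∫ Re⟨X t - X s, N⟩`;
  -- one factor of the norm then cancels.
  have hlip : ∀ s t, a ≤ s → s ≤ t → t ≤ b → ‖X t - X s‖ ≤ C * (t - s) := fun s t hs hst ht => by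
    have hsI : s ∈ Icc a b := ⟨hs, hst.trans ht⟩
    have htI : t ∈ Icc a b := ⟨hs.trans hst, ht⟩
    have h1 : ‖X t - X s‖ ^ 2 ≤ (C * ‖X t - X s‖) * (t - s) := by
      have e1 : ‖X t - X s‖ ^ 2 = (inner ℂ (X t) (X t - X s)).re - (inner ℂ (X s) (X t - X s)).re := by
        rw [← Complex.sub_re, ← inner_sub_left, inner_self_eq_norm_sq_to_K]
        norm_cast
      rw [e1, hX t htI s t hs hst ht, hX s hsI s t hs hst ht,
        ← intervalIntegral.integral_sub (hsub s t hs hst ht (hint t htI))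
          (hsub s t hs hst ht (hint s hsI))]
      have := intervalIntegral.norm_integral_le_of_norm_le_const (a := s) (b := t)
        (f := fun τ => (inner ℂ (X t) (N τ)).re - (inner ℂ (X s) (N τ)).re)
        (C := C * ‖X t - X s‖) fun τ hτ => by
          rw [uIoc_of_le hst] at hτ
          rw [← Complex.sub_re, ← inner_sub_left]
          refine (Complex.abs_re_le_norm _).trans ((norm_inner_le_norm _ _).trans ?_)
          rw [mul_comm]
          exact mul_le_mul_of_nonneg_right (hC τ ⟨hs.trans hτ.1.le, hτ.2.trans ht⟩) (norm_nonneg _)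
      rw [abs_of_nonneg (by linarith)] at this
      exact (le_abs_self _).trans this
    rcases (norm_nonneg (X t - X s)).eq_or_lt with h0 | h0
    · rw [← h0]; exact mul_nonneg hC0 (by linarith)
    · nlinarith
  -- The identity `‖X t‖² - ‖X s‖² = Re⟨X t + X s, X t - X s⟩` uses only the two admissible test
  -- vectors `X t` and `X s`.
  have hmain := le_of_quadratic_increments (F := fun t => ‖X t‖ ^ 2 - 2 * ∫ τ in a..t, g τ)
    (C := 2 * C ^ 2) hab fun s t hs hst ht => by
    have hsI : s ∈ Icc a b := ⟨hs, hst.trans ht⟩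
    have htI : t ∈ Icc a b := ⟨hs.trans hst, ht⟩
    have e1 : ‖X t‖ ^ 2 - ‖X s‖ ^ 2 =
        (inner ℂ (X t) (X t - X s)).re + (inner ℂ (X s) (X t - X s)).re := by
      have h1 := inner_self_eq_norm_sq (𝕜 := ℂ) (X t)
      have h2 := inner_self_eq_norm_sq (𝕜 := ℂ) (X s)
      have h3 := inner_re_symm (𝕜 := ℂ) (X t) (X s)
      simp only [RCLike.re_eq_complex_re] at h1 h2 h3
      rw [inner_sub_right, inner_sub_right, Complex.sub_re, Complex.sub_re, h1, h2, h3]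
      ring
    have e2 : (∫ τ in a..t, g τ) - ∫ τ in a..s, g τ = ∫ τ in s..t, g τ :=
      intervalIntegral.integral_interval_sub_left (hsub a t le_rfl (hs.trans hst) ht hg)
        (hsub a s le_rfl hs (hst.trans ht) hg)
    have it := hsub s t hs hst ht (hint t htI)
    have is := hsub s t hs hst ht (hint s hsI)
    have ig := hsub s t hs hst ht hg
    have e3 : (‖X t‖ ^ 2 - 2 * ∫ τ in a..t, g τ) - (‖X s‖ ^ 2 - 2 * ∫ τ in a..s, g τ) =
        ∫ τ in s..t, ((inner ℂ (X t) (N τ)).re + (inner ℂ (X s) (N τ)).re - 2 * g τ) := by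
      rw [intervalIntegral.integral_sub (it.add is) (ig.const_mul 2),
        intervalIntegral.integral_add it is, intervalIntegral.integral_const_mul, ← e2,
        ← hX t htI s t hs hst ht, ← hX s hsI s t hs hst ht, ← e1]
      ring
    rw [e3]
    have hae : ∀ᵐ τ ∂(volume.restrict (Icc s t)), -(2 * C ^ 2 * (t - s)) ≤
        (inner ℂ (X t) (N τ)).re + (inner ℂ (X s) (N τ)).re - 2 * g τ := by
      filter_upwards [ae_restrict_of_ae_restrict_of_subset (Icc_subset_Icc hs ht) hgN,
        ae_restrict_mem measurableSet_Icc] with τ h1 h2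
      -- Replacing either endpoint value by `X τ` costs at most `C · (t - s) · C`, so the integrated
      -- error is `2C²(t - s)²`.
      have hb : ∀ r q, ‖X r - X q‖ ≤ C * (t - s) →
          -(C ^ 2 * (t - s)) ≤ (inner ℂ (X r - X q) (N τ)).re := fun r q hrq => by
        have h3 : |(inner ℂ (X r - X q) (N τ)).re| ≤ ‖X r - X q‖ * ‖N τ‖ :=
          (Complex.abs_re_le_norm _).trans (norm_inner_le_norm _ _)
        have h4 : ‖X r - X q‖ * ‖N τ‖ ≤ (C * (t - s)) * C :=
          mul_le_mul hrq (hC τ ⟨hs.trans h2.1, h2.2.trans ht⟩) (norm_nonneg _)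
            (mul_nonneg hC0 (by linarith))
        have := neg_abs_le (inner ℂ (X r - X q) (N τ)).re
        nlinarith
      have h5 := hb t τ ((hlip τ t (hs.trans h2.1) h2.2 ht).trans
        (mul_le_mul_of_nonneg_left (by linarith [h2.1]) hC0))
      have h6 := hb s τ (by
        rw [norm_sub_rev]
        exact (hlip s τ hs h2.1 (h2.2.trans ht)).trans
          (mul_le_mul_of_nonneg_left (by linarith [h2.2]) hC0))
      rw [inner_sub_left, Complex.sub_re] at h5 h6
      linarith
    have := intervalIntegral.integral_mono_ae_restrict hst
      (intervalIntegrable_const (c := -(2 * C ^ 2 * (t - s)))) ((it.add is).sub (ig.const_mul 2)) hae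
    simp only [intervalIntegral.integral_const, smul_eq_mul] at this
    refine le_trans (le_of_eq ?_) this
    ring
  simp only [intervalIntegral.integral_same, mul_zero, sub_zero] at hmain
  linarith

/-! ### Measurability in time and the integrated momentum balance -/

/-- A weakly continuous curve in a separable Hilbert space is strongly measurable. -/
theorem stronglyMeasurable_of_weakly_continuous {E : Type*} [NormedAddCommGroup E]
    [InnerProductSpace ℝ E] [SecondCountableTopology E] {u : ℝ → E}
    (hu : ∀ w : E, Continuous fun t => inner ℝ (u t) w) : StronglyMeasurable u := by
  borelize E
  -- By duality, `‖u t - c‖ ≤ r` is an intersection of conditions on the functions `⟨u t, w⟩`, each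
  -- closed in `t`.
  have hlsc : ∀ c : E, LowerSemicontinuous fun t => ‖u t - c‖ := fun c => by
    rw [lowerSemicontinuous_iff_isClosed_preimage]
    intro r
    rcases lt_or_ge r 0 with hr | hr
    · have : (fun t => ‖u t - c‖) ⁻¹' Iic r = ∅ := by
        ext t
        simpa using hr.trans_le (norm_nonneg (u t - c))
      rw [this]
      exact isClosed_empty
    have : (fun t => ‖u t - c‖) ⁻¹' Iic r =
        ⋂ w : E, {t | inner ℝ (u t) w - inner ℝ c w ≤ r * ‖w‖} := by
      ext t
      simp only [mem_preimage, mem_Iic, mem_iInter, mem_ofPred_eq, ← inner_sub_left]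
      refine ⟨fun h w => (real_inner_le_norm _ _).trans
        (mul_le_mul_of_nonneg_right h (norm_nonneg _)), fun h => ?_⟩
      have h1 := h (u t - c)
      rw [real_inner_self_eq_norm_sq] at h1
      rcases (norm_nonneg (u t - c)).eq_or_lt with h0 | h0
      · rwa [← h0]
      · nlinarith
    rw [this]
    exact isClosed_iInter fun w => isClosed_le ((hu w).sub continuous_const) continuous_const
  refine Measurable.stronglyMeasurable (measurable_of_isOpen fun s hs => ?_)
  choose! ε hε hball using Metric.isOpen_iff.1 hs
  -- Separability makes every open set a countable union of balls, whose preimages are measurable by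
  -- semicontinuity.
  obtain ⟨T, hT, hTs⟩ := TopologicalSpace.isOpen_iUnion_countable
    (fun x : s => Metric.ball (x : E) (ε x)) fun _ => Metric.isOpen_ball
  have e1 : ⋃ x : s, Metric.ball (x : E) (ε x) = s := by
    refine Subset.antisymm (iUnion_subset fun x => hball x x.2) fun x hx => ?_
    exact mem_iUnion.2 ⟨⟨x, hx⟩, Metric.mem_ball_self (hε x hx)⟩
  rw [← e1, ← hTs, preimage_iUnion₂]
  refine MeasurableSet.biUnion hT fun x _ => ?_
  have : u ⁻¹' Metric.ball (x : E) (ε x) = {t | ‖u t - x‖ < ε x} := by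
    ext t; simp [dist_eq_norm]
  rw [this]
  exact measurableSet_lt (hlsc x).measurable measurable_const

/-- The bilinear map `(v, w) ↦ vᵢ w` from `L² × L²` to `L¹`. -/
noncomputable def tensor (i : Fin 3) : L2 →L[ℝ] L2 →L[ℝ] Lp R3 1 (volume : Measure R3) :=
  ((ContinuousLinearMap.lsmul ℝ ℝ : ℝ →L[ℝ] R3 →L[ℝ] R3).comp
    (EuclideanSpace.proj i : R3 →L[ℝ] ℝ)).holderL volume 2 2 1

/-- The momentum flux `vᵢ v`. -/
noncomputable def flux (i : Fin 3) (v : L2) : Lp R3 1 (volume : Measure R3) := tensor i v v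

lemma coeFn_flux (i : Fin 3) (v : L2) : flux i v =ᵐ[volume] fun x => v x i • v x :=
  ContinuousLinearMap.coeFn_holder _ v v

lemma continuous_flux (i : Fin 3) : Continuous (flux i) :=
  (tensor i).continuous.clm_apply continuous_id

lemma norm_flux_le (i : Fin 3) (v : L2) : ‖flux i v‖ ≤ ‖tensor i‖ * ‖v‖ ^ 2 := by
  rw [pow_two, ← mul_assoc]
  exact (tensor i).le_opNorm₂ v v

lemma integrable_inner_schwartz {p : ENNReal} [Fact (1 ≤ p)] (f : Lp R3 p (volume : Measure R3))
    (φ : 𝓢(R3, R3)) : Integrable fun x => inner ℝ (f x) (φ x) := by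
  have hp := ENNReal.HolderConjugate.inv_one_sub_inv' (Fact.out : 1 ≤ p)
  exact memLp_one_iff_integrable.1
    ((innerSL ℝ (E := R3)).memLp_of_bilin 1 (Lp.memLp f) (φ.memLp (1 - p⁻¹)⁻¹))

/-- The pairing of `Lᵖ` with a Schwartz field. -/
noncomputable def pairing (p : ENNReal) [hp : Fact (1 ≤ p)] (φ : 𝓢(R3, R3)) :
    Lp R3 p (volume : Measure R3) →L[ℝ] ℝ :=
  haveI := ENNReal.HolderConjugate.inv_one_sub_inv' hp.out
  haveI : Fact (1 ≤ (1 - p⁻¹)⁻¹) := by simp [fact_iff]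
  ((innerSL ℝ (E := R3)).lpPairing volume p (1 - p⁻¹)⁻¹).flip (φ.toLp (1 - p⁻¹)⁻¹)

lemma pairing_apply (p : ENNReal) [hp : Fact (1 ≤ p)] (φ : 𝓢(R3, R3))
    (f : Lp R3 p (volume : Measure R3)) : pairing p φ f = ∫ x, inner ℝ (f x) (φ x) := by
  have := ENNReal.HolderConjugate.inv_one_sub_inv' hp.out
  have : Fact (1 ≤ (1 - p⁻¹)⁻¹) := by simp [fact_iff]
  refine ((innerSL ℝ (E := R3)).lpPairing_eq_integral f (φ.toLp (1 - p⁻¹)⁻¹)).trans ?_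
  refine integral_congr_ae ?_
  filter_upwards [φ.coeFn_toLp (1 - p⁻¹)⁻¹ volume] with x hx
  rw [hx]; rfl

/-- The quadratic term becomes a continuous linear functional of the `L¹` fluxes, through which time
integrals can pass. -/
lemma integral_inner_fderiv (v : L2) (φ : 𝓢(R3, R3)) :
    ∫ x, inner ℝ (v x) (fderiv ℝ φ x (v x)) = ∑ i, pairing 1 (∂_{e i} φ) (flux i v) := by
  simp only [pairing_apply]
  rw [← integral_finsetSum _ fun i _ => integrable_inner_schwartz _ _]
  refine integral_congr_ae ?_
  filter_upwards [ae_all_iff.2 fun i => coeFn_flux i v] with x hx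
  have hv : v x = ∑ i, v x i • e i := by
    ext i
    simp [e, Finset.sum_apply, Pi.single_apply]
  have hd : fderiv ℝ φ x (v x) = ∑ i, v x i • fderiv ℝ φ x (e i) := by
    conv_lhs => rw [hv]
    simp
  rw [hd, inner_sum]
  simp only [hx, inner_smul_left, inner_smul_right, SchwartzMap.lineDerivOp_apply_eq_fderiv]
  simp

lemma intervalIntegrable_clm {E F : Type*} [NormedAddCommGroup E] [NormedSpace ℝ E]
    [NormedAddCommGroup F] [NormedSpace ℝ F] (L : E →L[ℝ] F) {f : ℝ → E} {s t : ℝ}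
    (hf : IntervalIntegrable f volume s t) : IntervalIntegrable (fun τ => L (f τ)) volume s t :=
  ⟨L.integrable_comp hf.1, L.integrable_comp hf.2⟩

lemma intervalIntegrable_sum {f : Fin 3 → ℝ → ℝ} {s t : ℝ}
    (hf : ∀ i, IntervalIntegrable (f i) volume s t) :
    IntervalIntegrable (fun τ => ∑ i, f i τ) volume s t := by
  have := IntervalIntegrable.sum Finset.univ fun i _ => hf i
  rwa [Finset.sum_fn] at this

namespace IsLeraySolution

variable {ν : ℝ} {u : ℝ → L2}

instance : SecondCountableTopology L2 :=
  have : Fact ((2 : ENNReal) ≠ ⊤) := ⟨ENNReal.ofNat_ne_top⟩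
  Lp.SecondCountableTopology

lemma aestronglyMeasurable_comp (hu : IsLeraySolution ν u) {E : Type*} [TopologicalSpace E]
    {G : L2 → E} (hG : Continuous G) :
    AEStronglyMeasurable (fun t => G (u t)) (volume.restrict (Ici (0 : ℝ))) := by
  -- Freezing the curve at `u 0` for negative times gives weak continuity on all of `ℝ`.
  have h1 : StronglyMeasurable fun t => u (max t 0) := by
    refine stronglyMeasurable_of_weakly_continuous fun w => ?_
    exact (hu.weak_continuous w).comp_continuous (f := fun t => max t 0) (by fun_prop)
      fun t => le_max_right t 0
  refine ⟨fun t => G (u (max t 0)), hG.comp_stronglyMeasurable h1, ?_⟩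
  filter_upwards [ae_restrict_mem measurableSet_Ici] with t ht
  rw [max_eq_left ht]

lemma intervalIntegrable_comp (hu : IsLeraySolution ν u) {E : Type*} [NormedAddCommGroup E]
    {G : L2 → E} (hG : Continuous G) {C : ℝ} (hC : ∀ t, 0 ≤ t → ‖G (u t)‖ ≤ C) {s t : ℝ}
    (hs : 0 ≤ s) (ht : 0 ≤ t) : IntervalIntegrable (fun t => G (u t)) volume s t := by
  have hsub : uIoc s t ⊆ Ici 0 := fun x hx => (le_min hs ht).trans hx.1.le
  refine (intervalIntegrable_const (c := C)).mono_fun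
    ((hu.aestronglyMeasurable_comp hG).mono_measure (Measure.restrict_mono hsub le_rfl)) ?_
  filter_upwards [ae_restrict_mem measurableSet_uIoc] with x hx
  exact (hC x (hsub hx)).trans (le_abs_self C)

lemma intervalIntegrable (hu : IsLeraySolution ν u) {s t : ℝ} (hs : 0 ≤ s) (ht : 0 ≤ t) :
    IntervalIntegrable u volume s t := by
  obtain ⟨C, hC⟩ := hu.bounded
  exact hu.intervalIntegrable_comp continuous_id hC hs ht

lemma intervalIntegrable_flux (hu : IsLeraySolution ν u) (i : Fin 3) {s t : ℝ} (hs : 0 ≤ s)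
    (ht : 0 ≤ t) : IntervalIntegrable (fun τ => flux i (u τ)) volume s t := by
  obtain ⟨C, hC⟩ := hu.bounded
  refine hu.intervalIntegrable_comp (continuous_flux i) (C := ‖tensor i‖ * C ^ 2) (fun t ht => ?_)
    hs ht
  refine (norm_flux_le i _).trans ?_
  gcongr
  exact hC t ht

/-- The momentum balance between two times. -/
theorem momentumBalance (hu : IsLeraySolution ν u) {s t : ℝ} (hs : 0 ≤ s) (ht : 0 ≤ t) :
    MomentumBalance ν (u t - u s) (∫ τ in s..t, u τ) fun i => ∫ τ in s..t, flux i (u τ) := by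
  intro φ hφ hdiv
  have hm := fun t ht => hu.momentum φ (isTest_of_hasCompactSupport φ hφ)
    (by simpa only [SchwartzMap.lineDerivOp_apply_eq_fderiv] using hdiv) t ht
  have e1 : ∀ τ, ν * (∫ x, inner ℝ (u τ x) (Δ (φ : R3 → R3) x)) +
      ∫ x, inner ℝ (u τ x) (fderiv ℝ φ x (u τ x)) =
      ν * pairing 2 (Δ φ) (u τ) + ∑ i, pairing 1 (∂_{e i} φ) (flux i (u τ)) := fun τ => by
    rw [integral_inner_fderiv, pairing_apply]
    simp only [SchwartzMap.laplacian_apply]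
  simp only [e1] at hm
  have i1 : IntervalIntegrable (fun τ => ν * pairing 2 (Δ φ) (u τ)) volume s t :=
    (intervalIntegrable_clm (pairing 2 (Δ φ)) (hu.intervalIntegrable hs ht)).const_mul ν
  have i2 : ∀ i, IntervalIntegrable (fun τ => pairing 1 (∂_{e i} φ) (flux i (u τ))) volume s t :=
    fun i => intervalIntegrable_clm _ (hu.intervalIntegrable_flux i hs ht)
  have e2 : ∀ r, 0 ≤ r → IntervalIntegrable (fun τ => ν * pairing 2 (Δ φ) (u τ) +
      ∑ i, pairing 1 (∂_{e i} φ) (flux i (u τ))) volume 0 r := fun r hr =>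
    ((intervalIntegrable_clm (pairing 2 (Δ φ))
      (hu.intervalIntegrable le_rfl hr)).const_mul ν).add
      (intervalIntegrable_sum fun i =>
        intervalIntegrable_clm _ (hu.intervalIntegrable_flux i le_rfl hr))
  have e3 := (congrArg₂ (· - ·) (hm t ht) (hm s hs)).trans
    (intervalIntegral.integral_interval_sub_left (e2 t ht) (e2 s hs))
  -- Time integrals pass through the pairings with `u` and with its fluxes separately. The integral
  -- of the flux is not the flux of the integral, hence the independent `U` and `Q` in
  -- `MomentumBalance`.
  rw [intervalIntegral.integral_add i1 (intervalIntegrable_sum i2),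
    intervalIntegral.integral_const_mul, intervalIntegral.integral_finsetSum fun i _ => i2 i,
    ContinuousLinearMap.intervalIntegral_comp_comm _ (hu.intervalIntegrable hs ht)] at e3
  simp only [fun i => ContinuousLinearMap.intervalIntegral_comp_comm (pairing 1 (∂_{e i} φ))
    (hu.intervalIntegrable_flux i hs ht), ← pairing_apply] at e3
  simp only [← pairing_apply]
  rw [← e3, map_sub]
  ring

end IsLeraySolution

/-! ### The filtered equation -/

/-- Bounded measurable Fourier multipliers of bounded support. -/
structure IsMultiplier (m : R3 → ℝ) : Prop where
  measurable : Measurable m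
  bounded : ∃ M, ∀ ξ, |m ξ| ≤ M
  support : ∃ R, ∀ ξ, R < ‖ξ‖ → m ξ = 0

/-- Bounded support absorbs the growth of derivative symbols. The case `p = ⊤` acts on transforms of
`L²` fields, and `p = 2` sends the bounded transforms of `L¹` fluxes into `L²`. -/
lemma IsMultiplier.memLp {m : R3 → ℝ} (hm : IsMultiplier m) {g : R3 → ℂ} (hg : Continuous g)
    (p : ENNReal) : MemLp (fun ξ => g ξ * m ξ) p := by
  obtain ⟨M, hM⟩ := hm.bounded
  obtain ⟨R, hR⟩ := hm.support
  obtain ⟨G, hG⟩ := (isCompact_closedBall (0 : R3) R).exists_bound_of_continuousOn hg.continuousOn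
  have e1 : (fun ξ => g ξ * m ξ) =
      (Metric.closedBall (0 : R3) R).indicator fun ξ => g ξ * m ξ := by
    ext ξ
    by_cases h : ξ ∈ Metric.closedBall (0 : R3) R
    · rw [indicator_of_mem h]
    · rw [indicator_of_notMem h, hR ξ (by simpa using h)]
      simp
  rw [e1, memLp_indicator_iff_restrict measurableSet_closedBall]
  have : IsFiniteMeasure (volume.restrict (Metric.closedBall (0 : R3) R)) :=
    ⟨by rw [Measure.restrict_apply_univ]; exact measure_closedBall_lt_top⟩
  refine MemLp.of_bound (hg.measurable.mul
    (Complex.measurable_ofReal.comp hm.measurable)).aestronglyMeasurable (G * M) ?_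
  filter_upwards [ae_restrict_mem measurableSet_closedBall] with ξ hξ
  rw [norm_mul, Complex.norm_real]
  exact mul_le_mul (hG ξ hξ) (hM ξ) (abs_nonneg _) ((norm_nonneg _).trans (hG ξ hξ))

/-- Multiplication by a bounded function on `L²`. -/
noncomputable def mulL2 (g : R3 → ℂ) (hg : MemLp g ⊤) : L2C →L[ℂ] L2C :=
  (ContinuousLinearMap.lsmul ℂ ℂ : ℂ →L[ℂ] C3 →L[ℂ] C3).holderL volume ⊤ 2 2 hg.toLp

lemma coeFn_mulL2 (g : R3 → ℂ) (hg : MemLp g ⊤) (f : L2C) :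
    mulL2 g hg f =ᵐ[volume] fun ξ => g ξ • f ξ := by
  refine (ContinuousLinearMap.coeFn_holder _ hg.toLp f).trans ?_
  filter_upwards [hg.coeFn_toLp] with ξ hξ
  rw [hξ]; rfl

lemma memLp_smul_bounded {g : R3 → ℂ} (hg : MemLp g 2) (f : BoundedContinuousFunction R3 C3) :
    MemLp (fun ξ => g ξ • f ξ) 2 :=
  (memLp_top_of_bound f.continuous.aestronglyMeasurable ‖f‖
    (.of_forall f.norm_coe_le_norm)).smul hg

/-- Multiplication by a square-integrable function, from bounded functions to `L²`. -/
noncomputable def mulBounded (g : R3 → ℂ) (hg : MemLp g 2) :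
    BoundedContinuousFunction R3 C3 →L[ℂ] L2C :=
  LinearMap.mkContinuous
    { toFun := fun f => (memLp_smul_bounded hg f).toLp
      map_add' := fun f f' => by
        rw [← MemLp.toLp_add]
        exact MemLp.toLp_congr _ _ (.of_forall fun ξ => smul_add _ _ _)
      map_smul' := fun c f => by
        rw [RingHom.id_apply, ← MemLp.toLp_const_smul]
        exact MemLp.toLp_congr _ _ (.of_forall fun ξ => smul_comm (g ξ) c (f ξ)) }
    ‖hg.toLp‖ fun f => by
      rw [mul_comm]
      refine Lp.norm_le_mul_norm_of_ae_le_mul ?_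
      filter_upwards [hg.coeFn_toLp, (memLp_smul_bounded hg f).coeFn_toLp] with ξ h1 h2
      rw [h1]
      simp only [LinearMap.coe_mk, AddHom.coe_mk]
      rw [h2, norm_smul, mul_comm]
      exact mul_le_mul_of_nonneg_right (f.norm_coe_le_norm ξ) (norm_nonneg _)

lemma coeFn_mulBounded (g : R3 → ℂ) (hg : MemLp g 2) (f : BoundedContinuousFunction R3 C3) :
    mulBounded g hg f =ᵐ[volume] fun ξ => g ξ • f ξ :=
  (memLp_smul_bounded hg f).coeFn_toLp

section Filtered

variable {m : R3 → ℝ} (hm : IsMultiplier m)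

/-- The Fourier transform of the filtered field. -/
noncomputable def filtered : L2 →L[ℝ] L2C :=
  ((mulL2 _ (hm.memLp (g := fun _ => 1) continuous_const ⊤)).restrictScalars ℝ).comp hat

lemma coeFn_filtered (v : L2) : filtered hm v =ᵐ[volume] fun ξ => (m ξ : ℂ) • hat v ξ := by
  filter_upwards [coeFn_mulL2 _ (hm.memLp (g := fun _ => 1) continuous_const ⊤) (hat v)] with ξ hξ
  refine Eq.trans hξ ?_
  rw [one_mul]

lemma continuous_coord (i : Fin 3) : Continuous fun ξ : R3 => (2 * Real.pi * (ξ i : ℝ) : ℂ) := by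
  fun_prop

/-- The Fourier transform of the `i`-th partial derivative of the filtered field, up to a factor
`i`. -/
noncomputable def filteredPartial (i : Fin 3) : L2 →L[ℝ] L2C :=
  ((mulL2 _ (hm.memLp (continuous_coord i) ⊤)).restrictScalars ℝ).comp hat

lemma coeFn_filteredPartial (i : Fin 3) (v : L2) : filteredPartial hm i v =ᵐ[volume]
    fun ξ => (2 * Real.pi * (ξ i : ℝ) * m ξ : ℂ) • hat v ξ :=
  coeFn_mulL2 _ (hm.memLp (continuous_coord i) ⊤) (hat v)

lemma continuous_laplacianSymbol :
    Continuous fun ξ : R3 => ((-(4 * Real.pi ^ 2 * ‖ξ‖ ^ 2 : ℝ)) : ℂ) := by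
  fun_prop

/-- The Fourier transform of the Laplacian of the filtered field. -/
noncomputable def filteredLaplacian : L2 →L[ℝ] L2C :=
  ((mulL2 _ (hm.memLp continuous_laplacianSymbol ⊤)).restrictScalars ℝ).comp hat

lemma coeFn_filteredLaplacian (v : L2) : filteredLaplacian hm v =ᵐ[volume]
    fun ξ => (-(4 * Real.pi ^ 2 * ‖ξ‖ ^ 2 : ℝ) * m ξ : ℂ) • hat v ξ :=
  coeFn_mulL2 _ (hm.memLp continuous_laplacianSymbol ⊤) (hat v)

lemma continuous_partialSymbol (i : Fin 3) :
    Continuous fun ξ : R3 => (2 * Real.pi * Complex.I * (ξ i : ℝ) : ℂ) := by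
  fun_prop

/-- The Fourier transform of the `i`-th partial derivative of a filtered integrable field. -/
noncomputable def filteredFlux (i : Fin 3) : Lp R3 1 (volume : Measure R3) →L[ℝ] L2C :=
  ((mulBounded _ (hm.memLp (continuous_partialSymbol i) 2)).restrictScalars ℝ).comp hatL1

lemma coeFn_filteredFlux (i : Fin 3) (q : Lp R3 1 (volume : Measure R3)) :
    filteredFlux hm i q =ᵐ[volume]
      fun ξ => (2 * Real.pi * Complex.I * (ξ i : ℝ) * m ξ : ℂ) • hatL1 q ξ :=
  coeFn_mulBounded _ (hm.memLp (continuous_partialSymbol i) 2) (hatL1 q)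

/-- The Fourier transform of the filtered right-hand side `νΔU - ∑ᵢ ∂ᵢQᵢ`. -/
noncomputable def filteredForce (ν : ℝ) (U : L2) (Q : Fin 3 → Lp R3 1 (volume : Measure R3)) :
    L2C :=
  ν • filteredLaplacian hm U - ∑ i, filteredFlux hm i (Q i)

lemma coeFn_filteredForce (ν : ℝ) (U : L2) (Q : Fin 3 → Lp R3 1 (volume : Measure R3)) :
    filteredForce hm ν U Q =ᵐ[volume] fun ξ =>
      (ν : ℂ) • (-(4 * Real.pi ^ 2 * ‖ξ‖ ^ 2 : ℝ) * m ξ : ℂ) • hat U ξ -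
        ∑ i, (2 * Real.pi * Complex.I * (ξ i : ℝ) * m ξ : ℂ) • hatL1 (Q i) ξ := by
  have h1 : ⇑(∑ i, filteredFlux hm i (Q i) : L2C) =ᵐ[volume]
      fun ξ => ∑ i, filteredFlux hm i (Q i) ξ := by
    filter_upwards [Lp.coeFn_add (filteredFlux hm 0 (Q 0) + filteredFlux hm 1 (Q 1))
      (filteredFlux hm 2 (Q 2)), Lp.coeFn_add (filteredFlux hm 0 (Q 0)) (filteredFlux hm 1 (Q 1))]
      with ξ h1 h2
    simp only [Fin.sum_univ_three]
    rw [h1, Pi.add_apply, h2, Pi.add_apply]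
  filter_upwards [h1, Lp.coeFn_sub (ν • filteredLaplacian hm U) (∑ i, filteredFlux hm i (Q i)),
    Lp.coeFn_smul ν (filteredLaplacian hm U), coeFn_filteredLaplacian hm U,
    ae_all_iff.2 fun i => coeFn_filteredFlux hm i (Q i)] with ξ h1 h2 h3 h4 h5
  refine h2.trans ?_
  rw [Pi.sub_apply, h3, Pi.smul_apply, h1, h4, Complex.coe_smul]
  simp only [h5]

/-- The filtered momentum balance in Fourier variables. -/
theorem inner_filtered_sub_force {ν : ℝ} {d U : L2}
    {Q : Fin 3 → Lp R3 1 (volume : Measure R3)} (h : MomentumBalance ν d U Q) {w : L2}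
    (hw : DivFree w) :
    inner ℂ (filtered hm w) (filtered hm d) = inner ℂ (filtered hm w) (filteredForce hm ν U Q) := by
  rw [← sub_eq_zero, ← inner_sub_right, L2.inner_def]
  refine integral_eq_zero_of_ae ?_
  filter_upwards [inner_hat_momentumSymbol h hw, coeFn_filtered hm w, coeFn_filtered hm d,
    Lp.coeFn_sub (filtered hm d) (filteredForce hm ν U Q), coeFn_filteredForce hm ν U Q]
    with ξ h1 h2 h3 h4 h5
  have e : (filtered hm d - filteredForce hm ν U Q : L2C) ξ =
      (m ξ : ℂ) • momentumSymbol ν d U Q ξ := by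
    have e1 : ∑ i, (2 * Real.pi * Complex.I * (ξ i : ℝ) * m ξ : ℂ) • hatL1 (Q i) ξ =
        (m ξ : ℂ) • ∑ i, (2 * Real.pi * Complex.I * (ξ i : ℝ) : ℂ) • hatL1 (Q i) ξ := by
      rw [Finset.smul_sum]
      exact Finset.sum_congr rfl fun i _ => by rw [smul_smul, mul_comm (m ξ : ℂ)]
    rw [h4, Pi.sub_apply, h3, h5, momentumSymbol, e1]
    module
  rw [e, h2, inner_smul_left, inner_smul_right, h1]
  simp

lemma continuous_filteredForce (ν : ℝ) :
    Continuous fun v : L2 => filteredForce hm ν v fun i => flux i v := by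
  unfold filteredForce
  exact ((filteredLaplacian hm).continuous.const_smul ν).sub
    (continuous_finsetSum _ fun i _ => (filteredFlux hm i).continuous.comp (continuous_flux i))

/-- Provides the bound on `N` required by `energy_growth`. It depends on the multiplier, which is
harmless because the filter is removed only afterwards. -/
lemma norm_filteredForce_le (ν : ℝ) (C : ℝ) :
    ∃ B, ∀ v : L2, ‖v‖ ≤ C → ‖filteredForce hm ν v fun i => flux i v‖ ≤ B := by
  refine ⟨‖ν‖ * (‖filteredLaplacian hm‖ * C) +
    ∑ i, ‖filteredFlux hm i‖ * (‖tensor i‖ * C ^ 2), fun v hv => ?_⟩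
  refine (norm_sub_le _ _).trans (add_le_add ?_ ((norm_sum_le _ _).trans
    (Finset.sum_le_sum fun i _ => ?_)))
  · rw [norm_smul]
    gcongr
    exact ((filteredLaplacian hm).le_opNorm v).trans (by gcongr)
  · refine ((filteredFlux hm i).le_opNorm _).trans ?_
    gcongr
    exact (norm_flux_le i v).trans (by gcongr)

lemma IsLeraySolution.intervalIntegrable_force {ν : ℝ} {u : ℝ → L2} (hu : IsLeraySolution ν u)
    {s t : ℝ} (hs : 0 ≤ s) (ht : 0 ≤ t) : IntervalIntegrable
      (fun τ => filteredForce hm ν (u τ) fun i => flux i (u τ)) volume s t := by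
  obtain ⟨C, hC⟩ := hu.bounded
  obtain ⟨B, hB⟩ := norm_filteredForce_le hm ν C
  exact hu.intervalIntegrable_comp (continuous_filteredForce hm ν) (fun t ht => hB _ (hC t ht)) hs ht

/-- The real part of the inner product with a fixed vector. -/
noncomputable def reInner (x : L2C) : L2C →L[ℝ] ℝ :=
  Complex.reCLM.comp ((innerSL ℂ x).restrictScalars ℝ)

/-- The filtered solution solves the filtered equation, tested against solenoidal fields. -/
theorem IsLeraySolution.inner_filtered_sub {ν : ℝ} {u : ℝ → L2} (hu : IsLeraySolution ν u)
    {s t : ℝ} (hs : 0 ≤ s) (ht : 0 ≤ t) {w : L2} (hw : DivFree w) :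
    (inner ℂ (filtered hm w) (filtered hm (u t) - filtered hm (u s))).re =
      ∫ τ in s..t,
        (inner ℂ (filtered hm w) (filteredForce hm ν (u τ) fun i => flux i (u τ))).re := by
  have h1 := inner_filtered_sub_force hm (hu.momentumBalance hs ht) hw
  -- The force is linear in the pair `(U, Q)`, so it commutes with integration in time.
  have h2 : filteredForce hm ν (∫ τ in s..t, u τ) (fun i => ∫ τ in s..t, flux i (u τ)) =
      ∫ τ in s..t, filteredForce hm ν (u τ) fun i => flux i (u τ) := by
    have i1 : IntervalIntegrable (fun τ => ν • filteredLaplacian hm (u τ)) volume s t :=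
      intervalIntegrable_clm (ν • filteredLaplacian hm) (hu.intervalIntegrable hs ht)
    have i2 := fun i => intervalIntegrable_clm (filteredFlux hm i)
      (hu.intervalIntegrable_flux i hs ht)
    have i3 : IntervalIntegrable (fun τ => ∑ i, filteredFlux hm i (flux i (u τ))) volume s t := by
      have := IntervalIntegrable.sum Finset.univ fun i _ => i2 i
      rwa [Finset.sum_fn] at this
    unfold filteredForce
    rw [intervalIntegral.integral_sub i1 i3, intervalIntegral.integral_finsetSum fun i _ => i2 i]
    have e1 : ∫ τ in s..t, ν • filteredLaplacian hm (u τ) =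
        ν • filteredLaplacian hm (∫ τ in s..t, u τ) :=
      ContinuousLinearMap.intervalIntegral_comp_comm (ν • filteredLaplacian hm)
        (hu.intervalIntegrable hs ht)
    rw [e1]
    simp only [fun i => ContinuousLinearMap.intervalIntegral_comp_comm (filteredFlux hm i)
      (hu.intervalIntegrable_flux i hs ht)]
  rw [h2, map_sub] at h1
  rw [h1]
  exact (ContinuousLinearMap.intervalIntegral_comp_comm (reInner (filtered hm w))
    (hu.intervalIntegrable_force hm hs ht)).symm

/-- The filtered energy inequality from below, given a lower bound for the energy input. -/
theorem IsLeraySolution.filtered_energy {ν : ℝ} {u : ℝ → L2} (hu : IsLeraySolution ν u)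
    {s t : ℝ} (hs : 0 ≤ s) (hst : s ≤ t)
    (h : ∀ᵐ τ ∂(volume.restrict (Icc s t)), -ν * ∑ i, ‖filteredPartial hm i (u τ)‖ ^ 2 ≤
      (inner ℂ (filtered hm (u τ)) (filteredForce hm ν (u τ) fun i => flux i (u τ))).re) :
    2 * ∫ τ in s..t, -ν * ∑ i, ‖filteredPartial hm i (u τ)‖ ^ 2 ≤
      ‖filtered hm (u t)‖ ^ 2 - ‖filtered hm (u s)‖ ^ 2 := by
  obtain ⟨C, hC⟩ := hu.bounded
  obtain ⟨B, hB⟩ := norm_filteredForce_le hm ν C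
  refine energy_growth (X := fun τ => filtered hm (u τ))
    (N := fun τ => filteredForce hm ν (u τ) fun i => flux i (u τ)) (C := B) hst
    (fun τ hτ => hB _ (hC τ (hs.trans hτ.1))) (fun r hr => ?_) (fun r hr a b ha hab hb => ?_) ?_ h
  · exact intervalIntegrable_clm (reInner (filtered hm (u r)))
      (hu.intervalIntegrable_force hm hs (hs.trans hst))
  · exact hu.inner_filtered_sub hm (hs.trans ha) (hs.trans (ha.trans hab))
      (hu.divFree r (hs.trans hr.1))
  · refine hu.intervalIntegrable_comp (G := fun v => -ν * ∑ i, ‖filteredPartial hm i v‖ ^ 2)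
      (by fun_prop) (C := |ν| * ∑ i, (‖filteredPartial hm i‖ * C) ^ 2) (fun τ hτ => ?_) hs
      (hs.trans hst)
    rw [norm_mul, norm_neg, Real.norm_eq_abs, Real.norm_of_nonneg (by positivity)]
    gcongr with i
    exact ((filteredPartial hm i).le_opNorm _).trans (by gcongr; exact hC τ hτ)

end Filtered

/-! ### The low-pass filter and the energy transfer -/

/-- The symbol of the low-pass filter. -/
noncomputable def cutoff (χ : ℝ → ℝ) (K : ℝ) (ξ : R3) : ℝ := χ (2 * Real.pi * ‖ξ‖ / K)

lemma IsCutoff.bounded {χ : ℝ → ℝ} (hχ : IsCutoff χ) : ∃ M, ∀ r, 0 ≤ r → |χ r| ≤ M := by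
  obtain ⟨M, hM⟩ := (isCompact_Icc (a := (0 : ℝ)) (b := 2)).exists_bound_of_continuousOn
    (hχ.smooth.continuousOn.mono Icc_subset_Ici_self)
  refine ⟨M, fun r hr => ?_⟩
  rcases le_or_gt r 2 with h | h
  · exact hM r ⟨hr, h⟩
  · rw [hχ.eq_zero r h, abs_zero]
    exact (norm_nonneg _).trans (hM 0 (by simp))

lemma IsCutoff.continuous_cutoff {χ : ℝ → ℝ} (hχ : IsCutoff χ) {K : ℝ} (hK : 0 < K) :
    Continuous (cutoff χ K) :=
  hχ.smooth.continuousOn.comp_continuous (by fun_prop) fun ξ => by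
    have := Real.pi_pos
    simp only [mem_Ici]; positivity

lemma IsCutoff.isMultiplier {χ : ℝ → ℝ} (hχ : IsCutoff χ) {K : ℝ} (hK : 0 < K) :
    IsMultiplier (cutoff χ K) where
  measurable := (hχ.continuous_cutoff hK).measurable
  bounded := by
    obtain ⟨M, hM⟩ := hχ.bounded
    exact ⟨M, fun ξ => hM _ (by have := Real.pi_pos; positivity)⟩
  -- `‖ξ‖ > K/π` is the condition that the argument `2π‖ξ‖/K` of `χ` exceeds `2`.
  support := ⟨K / Real.pi, fun ξ hξ => hχ.eq_zero _ (by
    have := Real.pi_pos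
    rw [div_lt_iff₀ this] at hξ
    rw [lt_div_iff₀ hK]
    linarith)⟩

lemma IsMultiplier.sq {m : R3 → ℝ} (hm : IsMultiplier m) : IsMultiplier fun ξ => m ξ ^ 2 where
  measurable := hm.measurable.pow_const 2
  bounded := by
    obtain ⟨M, hM⟩ := hm.bounded
    refine ⟨M ^ 2, fun ξ => ?_⟩
    rw [abs_pow]
    exact pow_le_pow_left₀ (abs_nonneg _) (hM ξ) 2
  support := by
    obtain ⟨R, hR⟩ := hm.support
    exact ⟨R, fun ξ hξ => by rw [hR ξ hξ]; norm_num⟩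

lemma fourier_coord {f : R3 → C3} (hf : Integrable f) (ξ : R3) (j : Fin 3) :
    𝓕 f ξ j = 𝓕 (fun x => f x j) ξ := by
  rw [Real.fourier_eq, Real.fourier_eq]
  refine ((EuclideanSpace.proj j : C3 →L[ℂ] ℂ).integral_comp_comm
    ((Real.fourierIntegral_convergent_iff ξ).2 hf)).symm.trans ?_
  rfl

lemma fourierInv_coord {f : R3 → C3} (hf : Integrable f) (x : R3) (j : Fin 3) :
    𝓕⁻ f x j = 𝓕⁻ (fun ξ => f ξ j) x := by
  rw [Real.fourierInv_eq_fourier_neg, Real.fourierInv_eq_fourier_neg, fourier_coord hf]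

lemma hatL1_flux (i j : Fin 3) (v : L2) (ξ : R3) :
    hatL1 (flux i v) ξ j = 𝓕 (fun x => ((v x i * v x j : ℝ) : ℂ)) ξ := by
  rw [hatL1_apply, fourier_coord (L1.integrable_coeFn _)]
  refine Real.fourier_congr_ae ?_ ξ
  filter_upwards [coeFn_cplx 1 (flux i v), coeFn_flux i v] with x h1 h2
  rw [h1, h2]
  simp

/-- The two inverse Fourier transforms agree on `L¹ ∩ L²`. -/
lemma coeFn_fourierInv_toLp {f : R3 → C3} (h1 : MemLp f 1) (h2 : MemLp f 2) :
    ((𝓕⁻ h2.toLp : L2C) : R3 → C3) =ᵐ[volume] 𝓕⁻ f := by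
  -- Both classes define the same tempered distribution, so the functions representing its inverse
  -- transform agree almost everywhere.
  have e : (Lp.toTemperedDistribution h1.toLp : 𝓢'(R3, C3)) = Lp.toTemperedDistribution h2.toLp := by
    ext1 ρ
    rw [Lp.toTemperedDistribution_apply, Lp.toTemperedDistribution_apply]
    refine integral_congr_ae ?_
    filter_upwards [h1.coeFn_toLp, h2.coeFn_toLp] with x hx hx'
    rw [hx, hx']
  have r1 := Represents.fourierInv_L1 h1.toLp
  rw [e] at r1
  refine ((Represents.fourierInv_L2 h2.toLp).ae_eq r1).trans (.of_forall fun x => ?_)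
  exact Real.fourierInv_congr_ae h1.coeFn_toLp x

lemma memLp_sq_smul_hatL1 {m : R3 → ℝ} (hm : IsMultiplier m) (q : Lp R3 1 (volume : Measure R3))
    (p : ENNReal) : MemLp (fun ξ => ((m ξ ^ 2 : ℝ) : ℂ) • hatL1 q ξ) p := by
  have h := hm.sq.memLp (g := fun _ => 1) continuous_const p
  simp only [one_mul] at h
  exact (memLp_top_of_bound (hatL1 q).continuous.aestronglyMeasurable ‖hatL1 q‖
    (.of_forall (hatL1 q).norm_coe_le_norm)).smul h

/-- The energy transfer in terms of the Fourier transform. -/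
lemma integral_lowPassSq {χ : ℝ → ℝ} (hχ : IsCutoff χ) {K : ℝ} (hK : 0 < K) (i : Fin 3) {v g : L2}
    (hg : IsWeakPartial i v g) :
    ∑ j, ∫ x, (lowPassSq χ K (fun y => v y i * v y j) x).re * g x j =
      -(inner ℂ (filtered (hχ.isMultiplier hK) v)
        (filteredFlux (hχ.isMultiplier hK) i (flux i v))).re := by
  set hm := hχ.isMultiplier hK
  set m := cutoff χ K
  have h1 := memLp_sq_smul_hatL1 hm (flux i v) 1
  have h2 := memLp_sq_smul_hatL1 hm (flux i v) 2
  set W : L2C := 𝓕⁻ h2.toLp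
  -- `lowPassSq` is a pointwise inverse Fourier integral; identifying it with the `L²` field `W`
  -- makes Plancherel available.
  have hW : ∀ j, ∀ᵐ x, lowPassSq χ K (fun y => v y i * v y j) x = W x j := fun j => by
    filter_upwards [coeFn_fourierInv_toLp h1 h2] with x hx
    rw [hx, fourierInv_coord (memLp_one_iff_integrable.1 h1), lowPassSq]
    simp only [PiLp.smul_apply, hatL1_flux, smul_eq_mul]
    rfl
  have e1 : (inner ℂ (cplx 2 g) W).re =
      ∑ j, ∫ x, (lowPassSq χ K (fun y => v y i * v y j) x).re * g x j := by
    have hi : ∀ j, Integrable fun x => (W x j).re * g x j := fun j => by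
      have a1 : MemLp (fun x => (W x j).re) 2 :=
        ((EuclideanSpace.proj j : C3 →L[ℂ] ℂ).comp_memLp' (Lp.memLp W)).re
      have a2 : MemLp (fun x => g x j) 2 :=
        (EuclideanSpace.proj j : R3 →L[ℝ] ℝ).comp_memLp' (Lp.memLp g)
      exact a1.integrable_mul a2
    rw [L2.inner_def]
    refine (integral_re (L2.integrable_inner (𝕜 := ℂ) (cplx 2 g) W)).symm.trans ?_
    have : ∀ j, ∫ x, (lowPassSq χ K (fun y => v y i * v y j) x).re * g x j =
        ∫ x, (W x j).re * g x j := fun j => integral_congr_ae (by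
      filter_upwards [hW j] with x hx
      rw [hx])
    simp only [this]
    rw [← integral_finsetSum _ fun j _ => hi j]
    refine integral_congr_ae ?_
    filter_upwards [coeFn_cplx 2 g] with x hx
    rw [hx, PiLp.inner_apply]
    simp
  have e2 : inner ℂ (cplx 2 g) W = inner ℂ (hat g) h2.toLp := by
    rw [← Lp.inner_fourier_eq, FourierTransform.fourier_fourierInv_eq, hat_apply]
  -- The factor `2πi ξᵢ` of `hat g` is conjugated on moving to the other side, whence the sign; `m²`
  -- splits evenly between the two sides.
  have e3 : inner ℂ (hat g) h2.toLp = -inner ℂ (filtered hm v) (filteredFlux hm i (flux i v)) := by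
    rw [L2.inner_def, L2.inner_def, ← integral_neg]
    refine integral_congr_ae ?_
    filter_upwards [hat_of_isWeakPartial hg, h2.coeFn_toLp, coeFn_filtered hm v,
      coeFn_filteredFlux hm i (flux i v)] with ξ a1 a2 a3 a4
    rw [a1, a2, a3, a4]
    simp only [inner_smul_left, inner_smul_right, map_mul, Complex.conj_ofReal, Complex.conj_I,
      map_ofNat]
    push_cast
    ring
  rw [← e1, e2, e3, Complex.neg_re]

/-- Integration by parts in Fourier form: `|ξ|² = ∑ᵢ ξᵢ²`. -/
lemma inner_filteredLaplacian {m : R3 → ℝ} (hm : IsMultiplier m) (v : L2) :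
    (inner ℂ (filtered hm v) (filteredLaplacian hm v)).re =
      -∑ i, ‖filteredPartial hm i v‖ ^ 2 := by
  have e1 : inner ℂ (filtered hm v) (filteredLaplacian hm v) =
      -∑ i, inner ℂ (filteredPartial hm i v) (filteredPartial hm i v) := by
    simp only [L2.inner_def]
    rw [← integral_finsetSum _ fun i _ => L2.integrable_inner _ _, ← integral_neg]
    refine integral_congr_ae ?_
    filter_upwards [coeFn_filtered hm v, coeFn_filteredLaplacian hm v,
      ae_all_iff.2 fun i => coeFn_filteredPartial hm i v] with ξ a1 a2 a3
    rw [a1, a2]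
    simp only [a3, inner_smul_left, inner_smul_right, map_mul, Complex.conj_ofReal,
      map_ofNat, EuclideanSpace.norm_sq_eq, Fin.sum_univ_three, Real.norm_eq_abs, sq_abs]
    push_cast
    ring
  rw [e1, Complex.neg_re, Complex.re_sum]
  simp only [inner_self_eq_norm_sq_to_K]
  norm_cast

/-- The energy input of the filtered equation: dissipation and nonlinear transfer. -/
theorem inner_filteredForce {χ : ℝ → ℝ} (hχ : IsCutoff χ) {K : ℝ} (hK : 0 < K) (ν : ℝ) {v : L2}
    (hv : MemH1 v) :
    (inner ℂ (filtered (hχ.isMultiplier hK) v)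
      (filteredForce (hχ.isMultiplier hK) ν v fun i => flux i v)).re =
      -ν * ∑ i, ‖filteredPartial (hχ.isMultiplier hK) i v‖ ^ 2 + energyTransfer χ K v := by
  have hw : ∀ i, IsWeakPartial i v (weakPartial i v) := fun i => by
    rw [weakPartial, dif_pos (hv i)]
    exact (hv i).choose_spec
  have e1 : energyTransfer χ K v = -∑ i, (inner ℂ (filtered (hχ.isMultiplier hK) v)
      (filteredFlux (hχ.isMultiplier hK) i (flux i v))).re := by
    rw [energyTransfer, ← Finset.sum_neg_distrib]
    exact Finset.sum_congr rfl fun i _ => integral_lowPassSq hχ hK i (hw i)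
  have e2 : ∀ x y : L2C, inner ℂ x (ν • y) = (ν : ℂ) * inner ℂ x y := fun x y => by
    rw [← inner_smul_right, ← algebraMap_smul ℂ ν y, Complex.coe_algebraMap]
  rw [filteredForce, inner_sub_right, inner_sum, Complex.sub_re, Complex.re_sum, e1, e2,
    Complex.re_ofReal_mul, inner_filteredLaplacian]
  ring

/-! ### Removal of the filter -/

lemma norm_sq_eq_integral (f : L2C) : ‖f‖ ^ 2 = ∫ ξ, ‖f ξ‖ ^ 2 := by
  rw [← inner_self_eq_norm_sq (𝕜 := ℂ) f, L2.inner_def,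
    ← integral_re (L2.integrable_inner (𝕜 := ℂ) f f)]
  simp only [inner_self_eq_norm_sq]

lemma integrable_norm_sq (f : L2C) : Integrable fun ξ => ‖f ξ‖ ^ 2 :=
  (Lp.memLp f).integrable_norm_pow two_ne_zero

lemma norm_hat (v : L2) : ‖hat v‖ = ‖v‖ := by
  rw [hat_apply, Lp.norm_fourier_eq, Lp.norm_def, Lp.norm_def]
  congr 1
  refine eLpNorm_congr_norm_ae ?_
  filter_upwards [coeFn_cplx 2 v] with x hx
  rw [hx, toC3.norm_map]

lemma norm_filtered_le {m : R3 → ℝ} (hm : IsMultiplier m) {M : ℝ} (hM : ∀ ξ, |m ξ| ≤ M) (v : L2) :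
    ‖filtered hm v‖ ≤ M * ‖v‖ := by
  rw [← norm_hat v]
  refine Lp.norm_le_mul_norm_of_ae_le_mul ?_
  filter_upwards [coeFn_filtered hm v] with ξ hξ
  rw [hξ, norm_smul, Complex.norm_real]
  exact mul_le_mul_of_nonneg_right (hM ξ) (norm_nonneg _)

/-- Allows the bound and the limit for filtered fields to be applied to `weakPartial i v`, and so to
the dissipation. -/
lemma norm_filteredPartial {m : R3 → ℝ} (hm : IsMultiplier m) {i : Fin 3} {v g : L2}
    (hg : IsWeakPartial i v g) : ‖filteredPartial hm i v‖ = ‖filtered hm g‖ := by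
  rw [Lp.norm_def, Lp.norm_def]
  congr 1
  refine eLpNorm_congr_norm_ae ?_
  filter_upwards [coeFn_filteredPartial hm i v, coeFn_filtered hm g, hat_of_isWeakPartial hg]
    with ξ h1 h2 h3
  rw [h1, h2, h3]
  simp only [norm_smul, norm_mul, Complex.norm_I, mul_one]
  ring

/-- The filter at the frequency `n + 1`. -/
lemma IsCutoff.isMultiplier_nat {χ : ℝ → ℝ} (hχ : IsCutoff χ) (n : ℕ) :
    IsMultiplier (cutoff χ ((n : ℝ) + 1)) :=
  hχ.isMultiplier (by positivity)

/-- Dominated convergence in frequency: at each fixed `ξ` the symbol is eventually `1`. -/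
lemma tendsto_norm_filtered {χ : ℝ → ℝ} (hχ : IsCutoff χ) (v : L2) :
    Tendsto (fun n : ℕ => ‖filtered (hχ.isMultiplier_nat n) v‖ ^ 2) atTop (𝓝 (‖v‖ ^ 2)) := by
  obtain ⟨M, hM⟩ := hχ.bounded
  rw [← norm_hat v, norm_sq_eq_integral]
  simp only [norm_sq_eq_integral]
  refine tendsto_integral_of_dominated_convergence (fun ξ => M ^ 2 * ‖hat v ξ‖ ^ 2)
    (fun n => (integrable_norm_sq _).aestronglyMeasurable) ((integrable_norm_sq _).const_mul _)
    (fun n => ?_) ?_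
  · filter_upwards [coeFn_filtered (hχ.isMultiplier_nat n) v] with ξ hξ
    rw [hξ, norm_smul, Complex.norm_real, Real.norm_of_nonneg (by positivity), mul_pow]
    gcongr
    exact hM _ (by have := Real.pi_pos; positivity)
  · filter_upwards [ae_all_iff.2 fun n => coeFn_filtered (hχ.isMultiplier_nat n) v] with ξ hξ
    refine tendsto_const_nhds.congr' ?_
    -- Beyond `4π‖ξ‖` the argument `2π‖ξ‖/(n + 1)` is below `1/2`, where `χ = 1`.
    obtain ⟨N, hN⟩ := exists_nat_gt (2 * (2 * Real.pi * ‖ξ‖))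
    filter_upwards [eventually_ge_atTop N] with n hn
    have hn' : (N : ℝ) ≤ n := by exact_mod_cast hn
    have h1 : cutoff χ ((n : ℝ) + 1) ξ = 1 := hχ.eq_one _ (by have := Real.pi_pos; positivity) (by
      rw [div_lt_iff₀ (by positivity)]
      linarith)
    rw [hξ n, h1]
    simp

/-- At each filter level the transfer is dropped by its sign, and then `n → ∞`. The exceptional null
set may depend on the level, since each level is integrated before the limit. -/
theorem IsLeraySolution.energy_ge {χ : ℝ → ℝ} (hχ : IsCutoff χ) {ν : ℝ}
    (hν : 0 < ν) {u : ℝ → L2} (hu : IsLeraySolution ν u)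
    {T₀ T₁ : ℝ} (hT₀ : 0 ≤ T₀)
    (hrev : ∀ K : ℝ, 0 < K → ∀ᵐ t ∂(volume.restrict (Icc T₀ T₁)), 0 ≤ energyTransfer χ K (u t))
    {s t : ℝ} (hs : T₀ ≤ s) (hst : s ≤ t) (ht : t ≤ T₁) :
    ‖u s‖ ^ 2 ≤ ‖u t‖ ^ 2 + 2 * ν * ∫ τ in s..t, gradNormSq (u τ) := by
  have hs0 : 0 ≤ s := hT₀.trans hs
  obtain ⟨M, hM⟩ := hχ.bounded
  have hH1 : ∀ᵐ τ ∂(volume.restrict (Icc s t)), MemH1 (u τ) :=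
    ae_restrict_of_ae_restrict_of_subset (fun x hx => hs0.trans hx.1) hu.memH1
  have key : ∀ n : ℕ,
      2 * ∫ τ in s..t, -ν * ∑ i, ‖filteredPartial (hχ.isMultiplier_nat n) i (u τ)‖ ^ 2 ≤
        ‖filtered (hχ.isMultiplier_nat n) (u t)‖ ^ 2 -
          ‖filtered (hχ.isMultiplier_nat n) (u s)‖ ^ 2 := fun n => by
    refine hu.filtered_energy _ hs0 hst ?_
    filter_upwards [hH1, ae_restrict_of_ae_restrict_of_subset (Icc_subset_Icc hs ht)
      (hrev ((n : ℝ) + 1) (by positivity))] with τ h1 h2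
    rw [inner_filteredForce hχ (by positivity) ν h1]
    linarith
  have hae : ∀ᵐ τ, τ ∈ uIoc s t → MemH1 (u τ) := by
    rw [uIoc_of_le hst]
    filter_upwards [(ae_restrict_iff' measurableSet_Icc).1 hH1] with τ h hτ
    exact h (Ioc_subset_Icc_self hτ)
  have hw : ∀ {v : L2}, MemH1 v → ∀ i, IsWeakPartial i v (weakPartial i v) := fun hv i => by
    rw [weakPartial, dif_pos (hv i)]
    exact (hv i).choose_spec
  have hlim : Tendsto (fun n : ℕ => ∫ τ in s..t,
      -ν * ∑ i, ‖filteredPartial (hχ.isMultiplier_nat n) i (u τ)‖ ^ 2) atTop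
      (𝓝 (∫ τ in s..t, -ν * gradNormSq (u τ))) := by
    have hG : IntervalIntegrable (fun τ => gradNormSq (u τ)) volume s t := by
      rw [intervalIntegrable_iff, uIoc_of_le hst]
      exact hu.integrable_gradNormSq.mono_set fun x hx => hs0.trans hx.1.le
    -- The bound `M` on `χ` may exceed `1`, which explains the factor `M²` in the dominating
    -- function.
    refine intervalIntegral.tendsto_integral_filter_of_dominated_convergence
      (fun τ => ν * (M ^ 2 * gradNormSq (u τ))) (.of_forall fun n => ?_) (.of_forall fun n => ?_)
      ((hG.const_mul _).const_mul _) ?_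
    · refine (hu.aestronglyMeasurable_comp
        (G := fun v => -ν * ∑ i, ‖filteredPartial (hχ.isMultiplier_nat n) i v‖ ^ 2)
        (by fun_prop)).mono_measure (Measure.restrict_mono ?_ le_rfl)
      rw [uIoc_of_le hst]
      exact fun x hx => hs0.trans hx.1.le
    · filter_upwards [hae] with τ hτ hmem
      rw [norm_mul, norm_neg, Real.norm_of_nonneg hν.le, Real.norm_of_nonneg (by positivity)]
      simp only [gradNormSq, Finset.mul_sum]
      gcongr with i
      rw [norm_filteredPartial _ (hw (hτ hmem) i), ← mul_pow]
      gcongr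
      exact norm_filtered_le _ (fun ξ => hM _ (by have := Real.pi_pos; positivity)) _
    · filter_upwards [hae] with τ hτ hmem
      refine (tendsto_finsetSum _ fun i _ => ?_).const_mul (-ν)
      simp only [norm_filteredPartial _ (hw (hτ hmem) i)]
      exact tendsto_norm_filtered hχ _
  have := le_of_tendsto_of_tendsto' (hlim.const_mul 2)
    ((tendsto_norm_filtered hχ (u t)).sub (tendsto_norm_filtered hχ (u s))) key
  rw [intervalIntegral.integral_const_mul] at this
  linarith

end NavierStokes

theorem mainTheorem12 (ν : ℝ) (hν : 0 < ν) (χ : ℝ → ℝ) (hχ : NavierStokes.IsCutoff χ)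
    (u : ℝ → NavierStokes.L2) (hu : NavierStokes.IsLeraySolution ν u)
    (T₀ T₁ : ℝ) (hT₀ : 0 ≤ T₀) (hT : T₀ ≤ T₁)
    (hrev : ∀ K : ℝ, 0 < K → ∀ᵐ t ∂(volume.restrict (Icc T₀ T₁)),
      0 ≤ NavierStokes.energyTransfer χ K (u t)) :
    (NavierStokes.EnergyInequalityFrom ν u T₀ →
      ∀ t ∈ Icc T₀ T₁, NavierStokes.EnergyEquality ν u T₀ t) ∧
    (∀ s t, T₀ < s → s ≤ t → t ≤ T₁ → NavierStokes.EnergyEquality ν u s t) := by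
  have key : ∀ r, T₀ ≤ r → NavierStokes.EnergyInequalityFrom ν u r → ∀ t, r ≤ t → t ≤ T₁ →
      NavierStokes.EnergyEquality ν u r t := fun r hr hE t hrt ht =>
    le_antisymm (hu.energy_ge hχ hν hT₀ hrev hr hrt ht) (hE t hrt)
  refine ⟨fun hE t ht => key T₀ le_rfl hE t ht.1 ht.2, fun s t hs hst ht => ?_⟩
  -- Leray's inequality need not be known from `s`. It holds from almost every time, hence from some
  -- `r` in the nonempty interval `(T₀, s)`; the equalities on `[r, s]` and `[r, t]` are then
  -- subtracted.
  obtain ⟨r, hr, hE⟩ : ∃ r ∈ Ioo T₀ s, NavierStokes.EnergyInequalityFrom ν u r := by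
    have h1 : ∀ᵐ r ∂(volume.restrict (Ioo T₀ s)), NavierStokes.EnergyInequalityFrom ν u r :=
      ae_restrict_of_ae_restrict_of_subset (fun x hx => hT₀.trans hx.1.le) hu.energy_ae
    have : (ae (volume.restrict (Ioo T₀ s))).NeBot := by
      rw [ae_neBot, Ne, Measure.restrict_eq_zero, Real.volume_Ioo]
      simpa using hs
    exact ((ae_restrict_mem measurableSet_Ioo).and h1).exists
  have e1 := key r hr.1.le hE s hr.2.le (hst.trans ht)
  have e2 := key r hr.1.le hE t (hr.2.le.trans hst) ht
  have hI : ∀ a b, r ≤ a → r ≤ b →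
      IntervalIntegrable (fun τ => NavierStokes.gradNormSq (u τ)) volume a b := fun a b ha hb => by
    rw [intervalIntegrable_iff]
    exact hu.integrable_gradNormSq.mono_set fun x hx =>
      (hT₀.trans hr.1.le).trans ((le_min ha hb).trans hx.1.le)
  have e3 := intervalIntegral.integral_add_adjacent_intervals (hI r s le_rfl hr.2.le)
    (hI s t hr.2.le (hr.2.le.trans hst))
  unfold NavierStokes.EnergyEquality at e1 e2 ⊢
  rw [← e3] at e2
  linarith
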